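/- **Setting.** Let $p$ be a prime, $V$ a finite-dimensional $\mathbb Q$-vector space and $L\subset V$ a lattice (a finitely generated subgroup spanning $V$ over $\mathbb Q$). For a prime $\ell$ put $V_\ell=\mathbb Q_\ell\otimes_{\mathbb Q}V$ and let $L_\ell\subset V_\ell$ be the $\mathbb Z_\ell$-span of $L$. Let $V^{(p)}=\prod'_{\ell\ne p}V_\ell$ be the restricted product with respect to the $L_\ell$, and $\mathbb Q^{(p)}=\prod'_{\ell\neq p}\mathbb Q_\ell$ the restricted product with respect to the $\mathbb Z_\ell$; $V$ is embedded diagonally in $V^{(p)}$. A *test function away from $p$* is a locally constant, compactly supported function $f':V^{(p)}\to\mathbb Z$. For $v\in V$ put $(f'\otimes[L_p])(v)=f'(v)$ if $v\in L_p$ and $0$ otherwise. Write $f'\in\mathcal S^{(p)}(L)$ if $f'\otimes[L_p]$ vanishes at every $v\in V\setminus L$. **Vanishing hypothesis.** Let $h^{(p)}$ be the Haar integral on $\mathbb Q^{(p)}$ normalised by $h^{(p)}([\prod_{\ell\ne p}\mathbb Z_\ell])=1$. For $v\in V\setminus\{0\}$, $f'$ satisfies the *vanishing hypothesis for $v$*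 if for every $w\in V$ the function $f'_{v,w}(t)=f'(w+tv)$ on $\mathbb Q^{(p)}$ has $h^{(p)}(f'_{v,w})=0$. **Cones.** For linearly independent $v_1,\dots,v_r\in V$ let $C^o(v_1,\dots,v_r)=\{\sum a_iv_i: a_i\in\mathbb R,\ a_i>0\}\subset \mathbb R\otimes_{\mathbb Q} V$ (it is $\{0\}$ if $r=0$). A *(rational) simplicial cone with extremal rays* $v_1,\dots,v_r\in V$ is a finite disjoint union $C$ of open cones $C^o((v_i)_{i\in S})$, where each $S\subset\{1,\dots,r\}$ that occurs indexes a linearly independent family and every $i$ lies in some $S$ that occurs. (The open cone $C^o(v_1,\dots,v_r)$ with $v_1,\dots,v_r$ linearly independent is the basic example.) **Pseudo-measures.** Let $\mathcal M(L_p)$ be the convolution ring of continuous $\mathbb Q_p$-linear functionals on $\mathcal C(L_p,\mathbb Q_p)$, let $\delta_v$ be the Dirac measure at $v\in L$, and let $\widetilde{\mathcal M}(L_p)$ be the localization of $\mathcal M(L_p)$ at the multiplicative set generated by the $1-\delta_v$, $0\ne v\in L$. Let $\varphi$ be the ring homomorphism from the localization of the group ring $\mathbb Q[q^v]_{v\in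 L}$ at the multiplicative set generated by the $1-q^v$, $0\neq v\in L$, to $\widetilde{\mathcal M}(L_p)$ with $\varphi(q^v)=\delta_v$. For $f'\in\mathcal S^{(p)}(L)$, $f=f'\otimes[L_p]$ and a simplicial cone $C$ let $$G_{C,f}=\sum_{v\in C\cap L}f(v)\,q^v,$$ regarded as a rational function: $G_{C,f}=N/D$ where $N\in\mathbb Q[q^v]_{v\in L}$, $D$ is in the multiplicative set generated by the $1-q^v$ ($0\ne v\in L$), and $D\cdot\sum_{v\in C\cap L}f(v)q^v=N$ as formal series; there is at most one such element $N/D$ of the localization. Put $\mu_{f',C}=\varphi(G_{C,f})\in\widetilde{\mathcal M}(L_p)$. **Theorem.** Let $C$ be a simplicial cone with extremal rays $v_1,\dots,v_r\in V$ and let $f'\in\mathcal S^{(p)}(L)$ satisfy the vanishing hypothesis for each of $v_1,\dots,v_r$. Then the pseudo-measure $\mu_{f',C}\in\widetilde{\mathcal M}(L_p)$ exists (i.e. the series $G_{C,f}$ is rational in the above sense) and is a measure: it lies in the image of $\mathcal M(L_p)\to\widetilde{\mathcal M}(L_p)$. -/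

import Mathlib

open scoped TensorProduct RestrictedProduct

noncomputable section

namespace ShintaniMeasure

/-! ### `p`-adic measures on a profinite abelian group -/

section Measures

variable (p : ℕ) [Fact p.Prime] (G : Type*) [TopologicalSpace G]

/-- `ℚ_p`-valued measures on `G`: continuous `ℚ_p`-linear functionals on `C(G, ℚ_p)`
(Mathlib's `AbstractMeasure`). -/
abbrev PadicMeasure : Type _ := AbstractMeasure G ℚ_[p] ℚ_[p]

variable {p G} [AddCommGroup G] [IsTopologicalAddGroup G]

/-- The addition of `G` as a continuous map. -/
def addMap (G : Type*) [TopologicalSpace G] [AddCommGroup G] [IsTopologicalAddGroup G] :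
    C(G × G, G) := ⟨fun x => x.1 + x.2, continuous_add⟩

/-- Convolution: the push-forward of the product measure under addition, so that
`(μ * ν)(f) = ∫ (∫ f (x + y) dμ(x)) dν(y)`. -/
def conv [CompactSpace G] (μ ν : PadicMeasure p G) : PadicMeasure p G :=
  AbstractMeasure.map (addMap G) (AbstractMeasure.prodMk μ ν)

theorem conv_apply [CompactSpace G] (μ ν : PadicMeasure p G) (f : C(G, ℚ_[p])) :
    conv μ ν f = ν ⟨fun y => μ ⟨fun x => f (x + y), by fun_prop⟩,
      (AbstractMeasure.contractFst μ (f.comp (addMap G))).continuous⟩ := rfl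

variable [CompactSpace G] [T2Space G] [TotallyDisconnectedSpace G]

theorem conv_comm (μ ν : PadicMeasure p G) : conv μ ν = conv ν μ := by
  have h : AbstractMeasure.prodMk μ ν = AbstractMeasure.prodMk' μ ν :=
    AbstractMeasure.prodMk_eq_prodMk' μ ν
  apply DFunLike.ext
  intro f
  unfold conv
  rw [h, AbstractMeasure.map_apply, AbstractMeasure.prodMk'_flip, AbstractMeasure.map_apply]
  congr 1
  ext x
  simp [addMap, add_comm]

/-- The convolution ring of measures. -/
instance : CommRing (PadicMeasure p G) :=
  { (inferInstance : AddCommGroup (PadicMeasure p G)) with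
    mul := conv
    one := AbstractMeasure.dirac ℚ_[p] (0 : G)
    left_distrib := fun a b c => by
      change conv a (b + c) = conv a b + conv a c
      simp [conv]
    right_distrib := fun a b c => by
      change conv (a + b) c = conv a c + conv b c
      simp [conv]
    zero_mul := fun a => by
      change conv 0 a = 0
      simp [conv]
    mul_zero := fun a => by
      change conv a 0 = 0
      simp [conv]
    mul_assoc := fun a b c => by
      change conv (conv a b) c = conv a (conv b c)
      apply DFunLike.ext
      intro f
      simp only [conv_apply]
      congr 1
      ext z
      change b _ = b _
      congr 1
      ext y
      change a _ = a _
      congr 1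
      ext x
      exact congrArg f (add_assoc x y z)
    one_mul := fun a => by
      change conv (AbstractMeasure.dirac ℚ_[p] (0 : G)) a = a
      apply DFunLike.ext
      intro f
      rw [conv_apply]
      congr 1
      ext y
      exact congrArg f (zero_add y)
    mul_one := fun a => by
      change conv a (AbstractMeasure.dirac ℚ_[p] (0 : G)) = a
      apply DFunLike.ext
      intro f
      rw [conv_apply]
      change a _ = a _
      congr 1
      ext y
      exact congrArg f (add_zero y)
    mul_comm := conv_comm }

theorem mul_def (μ ν : PadicMeasure p G) : μ * ν = conv μ ν := rfl

theorem one_def : (1 : PadicMeasure p G) = AbstractMeasure.dirac ℚ_[p] (0 : G) := rfl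

theorem dirac_add (x y : G) : (AbstractMeasure.dirac ℚ_[p] (x + y) : PadicMeasure p G) =
    AbstractMeasure.dirac ℚ_[p] x * AbstractMeasure.dirac ℚ_[p] y := by
  apply DFunLike.ext
  intro f
  rw [mul_def, conv_apply]
  rfl

/-- Constant multiples of the unit `δ₀`, as a ring homomorphism. -/
def constHom : ℚ_[p] →+* PadicMeasure p G where
  toFun c := c • (1 : PadicMeasure p G)
  map_one' := one_smul _ _
  map_zero' := zero_smul _ _
  map_add' a b := add_smul a b _
  map_mul' a b := by
    have key : ∀ (c : ℚ_[p]) (x y : PadicMeasure p G), (c • x) * y = c • (x * y) := by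
      intro c x y
      simp [mul_def, conv]
    rw [key, one_mul, mul_smul]

end Measures

/-! ### Local completions of a lattice -/

section Local

variable (ℓ : ℕ) [Fact ℓ.Prime] (V : Type*) [AddCommGroup V] [Module ℚ V]

/-- `V_ℓ = ℚ_ℓ ⊗ V`. -/
abbrev Vloc : Type _ := ℚ_[ℓ] ⊗[ℚ] V

/-- `V_ℓ` carries its canonical topology as a `ℚ_ℓ`-vector space. -/
instance : TopologicalSpace (Vloc ℓ V) := moduleTopology ℚ_[ℓ] (Vloc ℓ V)

instance : IsModuleTopology ℚ_[ℓ] (Vloc ℓ V) := ⟨rfl⟩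

instance : IsTopologicalAddGroup (Vloc ℓ V) :=
  IsModuleTopology.topologicalAddGroup ℚ_[ℓ] (Vloc ℓ V)

variable {V}

/-- The canonical map `V → V_ℓ`. -/
def toLoc (v : V) : Vloc ℓ V := (1 : ℚ_[ℓ]) ⊗ₜ[ℚ] v

theorem toLoc_add (v w : V) : toLoc ℓ (v + w) = toLoc ℓ v + toLoc ℓ w :=
  TensorProduct.tmul_add _ _ _

variable (L : Submodule ℤ V)

/-- `L_ℓ`, the `ℤ_ℓ`-span of `L` in `V_ℓ`. -/
def Lloc : Submodule ℤ_[ℓ] (Vloc ℓ V) := Submodule.span ℤ_[ℓ] (toLoc ℓ '' (L : Set V))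

theorem toLoc_mem {v : V} (hv : v ∈ L) : toLoc ℓ v ∈ Lloc ℓ L :=
  Submodule.subset_span ⟨v, hv, rfl⟩

/-- The canonical map `L → L_ℓ`. -/
def latticeToLoc (v : L) : Lloc ℓ L := ⟨toLoc ℓ (v : V), toLoc_mem ℓ L v.2⟩

theorem latticeToLoc_add (v w : L) :
    latticeToLoc ℓ L (v + w) = latticeToLoc ℓ L v + latticeToLoc ℓ L w :=
  Subtype.ext (toLoc_add ℓ (v : V) (w : V))

theorem latticeToLoc_zero : latticeToLoc ℓ L 0 = 0 :=
  Subtype.ext (TensorProduct.tmul_zero _ _)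

instance : IsTopologicalAddGroup (Lloc ℓ L) :=
  inferInstanceAs (IsTopologicalAddGroup (Lloc ℓ L).toAddSubgroup)

variable [hL : L.IsLattice ℚ]

theorem finite_of_lattice (L : Submodule ℤ V) [hL : L.IsLattice ℚ] : Module.Finite ℚ V := by
  obtain ⟨s, hs⟩ := hL.fg
  refine ⟨⟨s, ?_⟩⟩
  rw [← hL.span_eq_top, ← hs]
  exact (Submodule.span_span_of_tower ℤ ℚ (s : Set V)).symm

/-- An injective continuous linear map from `V_ℓ` to a finite product of copies of `ℚ_ℓ`. -/
theorem exists_coord (L : Submodule ℤ V) [L.IsLattice ℚ] : ∃ (n : ℕ) (φ : Vloc ℓ V → Fin n → ℚ_[ℓ]),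
    Continuous φ ∧ Function.Injective φ := by
  have := finite_of_lattice L
  let b := Module.finBasis ℚ_[ℓ] (Vloc ℓ V)
  have hc := IsModuleTopology.continuous_of_linearMap b.equivFun.toLinearMap
  exact ⟨_, b.equivFun, hc, b.equivFun.injective⟩

instance : T2Space (Lloc ℓ L) := by
  obtain ⟨n, φ, hc, hi⟩ := exists_coord ℓ L
  exact T2Space.of_injective_continuous (hi.comp Subtype.val_injective)
    (hc.comp continuous_subtype_val)

instance : TotallyDisconnectedSpace (Lloc ℓ L) := by
  obtain ⟨n, φ, hc, hi⟩ := exists_coord ℓ L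
  refine ⟨isTotallyDisconnected_of_image (f := φ ∘ Subtype.val)
    (hc.comp continuous_subtype_val).continuousOn (hi.comp Subtype.val_injective) ?_⟩
  exact isTotallyDisconnected_of_totallyDisconnectedSpace _

instance : CompactSpace (Lloc ℓ L) := by
  refine isCompact_iff_compactSpace.1 (?_ : IsCompact (Lloc ℓ L : Set (Vloc ℓ V)))
  obtain ⟨s, hs⟩ := hL.fg
  have h1 : Lloc ℓ L = Submodule.span ℤ_[ℓ] (Set.range fun x : s => toLoc ℓ (x : V)) := by
    apply le_antisymm
    · refine Submodule.span_le.2 ?_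
      rintro _ ⟨v, hv, rfl⟩
      rw [← hs] at hv
      induction hv using Submodule.span_induction with
      | mem x hx => exact Submodule.subset_span ⟨⟨x, hx⟩, rfl⟩
      | zero => rw [toLoc, TensorProduct.tmul_zero]; exact Submodule.zero_mem _
      | add x y _ _ hx hy => rw [toLoc_add]; exact Submodule.add_mem _ hx hy
      | smul a x _ hx =>
        have : toLoc ℓ (a • x) = a • toLoc ℓ x := by
          simp [toLoc]
        rw [this]
        exact zsmul_mem hx a
    · refine Submodule.span_le.2 ?_
      rintro _ ⟨x, rfl⟩
      exact toLoc_mem ℓ L (hs ▸ Submodule.subset_span x.2)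
  have h2 : (Lloc ℓ L : Set (Vloc ℓ V)) =
      Set.range fun a : s → ℤ_[ℓ] => ∑ x, ((a x : ℤ_[ℓ]) : ℚ_[ℓ]) • toLoc ℓ (x : V) := by
    rw [h1]
    ext y
    rw [SetLike.mem_coe, Submodule.mem_span_range_iff_exists_fun]
    rfl
  rw [h2]
  refine isCompact_range ?_
  refine continuous_finsetSum _ fun x _ => ?_
  have hc : Continuous ((↑) : ℤ_[ℓ] → ℚ_[ℓ]) := PadicInt.isOpenEmbedding_coe.continuous
  have hx : Continuous fun a : s → ℤ_[ℓ] => ((a x : ℤ_[ℓ]) : ℚ_[ℓ]) :=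
    hc.comp (continuous_apply x)
  have hy : Continuous fun _ : s → ℤ_[ℓ] => toLoc ℓ (x : V) := continuous_const
  exact hx.smul hy

/-- Every vector of `V` has a non-zero integral multiple in `L`. -/
theorem exists_smul_mem (v : V) : ∃ m : ℤ, m ≠ 0 ∧ m • v ∈ L := by
  have hv : v ∈ Submodule.span ℚ (L : Set V) := by rw [hL.span_eq_top]; trivial
  induction hv using Submodule.span_induction with
  | mem x hx => exact ⟨1, one_ne_zero, by simpa using hx⟩
  | zero => exact ⟨1, one_ne_zero, by simp⟩
  | add x y _ _ hx hy =>
    obtain ⟨m, hm, hx⟩ := hx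
    obtain ⟨k, hk, hy⟩ := hy
    refine ⟨m * k, mul_ne_zero hm hk, ?_⟩
    rw [smul_add]
    refine L.add_mem ?_ ?_
    · rw [mul_comm, mul_smul]; exact L.smul_mem k hx
    · rw [mul_smul]; exact L.smul_mem m hy
  | smul a x _ hx =>
    obtain ⟨m, hm, hx⟩ := hx
    refine ⟨a.den * m, mul_ne_zero (by exact_mod_cast a.den_nz) hm, ?_⟩
    have : ((a.den : ℤ) * m) • a • x = a.num • m • x := by
      rw [← Int.cast_smul_eq_zsmul ℚ, ← Int.cast_smul_eq_zsmul ℚ a.num,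
        ← Int.cast_smul_eq_zsmul ℚ m, smul_smul, smul_smul]
      congr 1
      have := Rat.den_mul_eq_num a
      push_cast
      linear_combination (m : ℚ) * this
    rw [this]
    exact L.smul_mem _ hx

end Local

/-! ### Test functions away from `p` -/

section TestFunctions

/-- The primes different from `p`. -/
abbrev PrimesAway (p : ℕ) : Type := {ℓ : Nat.Primes // (ℓ : ℕ) ≠ p}

variable (p : ℕ)

instance (ℓ : PrimesAway p) : Fact ((ℓ.1 : ℕ)).Prime := ⟨ℓ.1.2⟩

/-- `ℚ^(p)`: the ring of finite adeles of `ℚ` away from `p`. -/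
abbrev AdeleQ : Type := Πʳ ℓ : PrimesAway p, [ℚ_[(ℓ.1 : ℕ)], PadicInt.subring (ℓ.1 : ℕ)]

variable {V : Type*} [AddCommGroup V] [Module ℚ V] (L : Submodule ℤ V)

/-- `V^(p)`: the finite adeles of `V` away from `p`, the restricted product of the `V_ℓ`, `ℓ ≠ p`,
with respect to the `L_ℓ`. (As a topological group it does not depend on the lattice `L`.) -/
abbrev AdeleV : Type _ :=
  Πʳ ℓ : PrimesAway p, [Vloc (ℓ.1 : ℕ) V, (Lloc (ℓ.1 : ℕ) L : Set (Vloc (ℓ.1 : ℕ) V))]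

/-- The test functions away from `p`: the Bruhat-Schwartz functions on the finite adeles of `V`
away from `p`, i.e. the locally constant functions `V^(p) → ℤ` with compact support. -/
structure TestFunction where
  toFun : AdeleV p L → ℤ
  isLocallyConstant : IsLocallyConstant toFun
  hasCompactSupport : HasCompactSupport toFun

theorem finite_primes_dvd {m : ℤ} (hm : m ≠ 0) :
    ∀ᶠ ℓ : PrimesAway p in Filter.cofinite, ¬ ((ℓ.1 : ℕ) : ℤ) ∣ m := by
  rw [Filter.eventually_cofinite]
  refine Set.Finite.of_finite_image (f := fun ℓ : PrimesAway p => (ℓ.1 : ℕ)) ?_ ?_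
  · refine (Finset.finite_toSet m.natAbs.divisors).subset ?_
    rintro _ ⟨ℓ, hl, rfl⟩
    simp only [Finset.mem_coe, Nat.mem_divisors]
    exact ⟨Int.natCast_dvd.1 (not_not.1 hl), Int.natAbs_ne_zero.2 hm⟩
  · intro a _ b _ h
    exact Subtype.ext (Subtype.ext h)

variable [hL : L.IsLattice ℚ]

theorem eventually_toLoc_mem (v : V) :
    ∀ᶠ ℓ : PrimesAway p in Filter.cofinite, toLoc (ℓ.1 : ℕ) v ∈ Lloc (ℓ.1 : ℕ) L := by
  obtain ⟨m, hm, hv⟩ := exists_smul_mem L v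
  filter_upwards [finite_primes_dvd p hm] with ℓ hl
  have hu : IsUnit ((m : ℤ) : ℤ_[(ℓ.1 : ℕ)]) := by
    rw [PadicInt.isUnit_iff]
    refine le_antisymm (PadicInt.norm_le_one _) (not_lt.1 fun h => hl ?_)
    exact (PadicInt.norm_int_lt_one_iff_dvd m).1 h
  have h := toLoc_mem (ℓ.1 : ℕ) L hv
  have h2 : toLoc (ℓ.1 : ℕ) (m • v) = ((m : ℤ) : ℤ_[(ℓ.1 : ℕ)]) • toLoc (ℓ.1 : ℕ) v := by
    rw [Int.cast_smul_eq_zsmul]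
    simp [toLoc]
  rw [h2] at h
  exact (Submodule.smul_mem_iff_of_isUnit _ hu).1 h

/-- The affine line `t ↦ w + t v`, from `ℚ^(p)` to `V^(p)`. -/
def line (v w : V) (t : AdeleQ p) : AdeleV p L :=
  RestrictedProduct.mk (fun ℓ => toLoc (ℓ.1 : ℕ) w + t ℓ • toLoc (ℓ.1 : ℕ) v) <| by
    filter_upwards [eventually_toLoc_mem p L v, eventually_toLoc_mem p L w, t.2]
      with ℓ hv hw ht
    exact Submodule.add_mem _ hw
      ((Lloc (ℓ.1 : ℕ) L).smul_mem (⟨t ℓ, ht⟩ : ℤ_[(ℓ.1 : ℕ)]) hv)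

/-- The diagonal embedding of `V` in `V^(p)`. -/
def diag (v : V) : AdeleV p L :=
  RestrictedProduct.mk (fun ℓ => toLoc (ℓ.1 : ℕ) v) (eventually_toLoc_mem p L v)

variable {p L}

open scoped Classical in
/-- The values on `V` of the test function `f' ⊗ [L_p]`. -/
def TestFunction.tensorLp [Fact p.Prime] (f' : TestFunction p L) (v : V) : ℤ :=
  if toLoc p v ∈ Lloc p L then f'.toFun (diag p L v) else 0

/-- `f' ∈ 𝒮^(p)(L)`: the test function `f' ⊗ [L_p]` vanishes at every `v ∈ V` outside `L`. -/
def TestFunction.SupportedOn [Fact p.Prime] (f' : TestFunction p L) : Prop :=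
  ∀ v : V, v ∉ L → f'.tensorLp v = 0

end TestFunctions

/-! ### Haar measure and the vanishing hypothesis -/

section Haar

variable (p : ℕ)

instance (ℓ : PrimesAway p) : CompactSpace (PadicInt.subring (ℓ.1 : ℕ)) :=
  inferInstanceAs (CompactSpace ℤ_[(ℓ.1 : ℕ)])

instance : Fact (∀ ℓ : PrimesAway p,
    IsOpen (PadicInt.subring (ℓ.1 : ℕ) : Set ℚ_[(ℓ.1 : ℕ)])) :=
  ⟨fun ℓ => by
    have h : (PadicInt.subring (ℓ.1 : ℕ) : Set ℚ_[(ℓ.1 : ℕ)]) = Metric.closedBall 0 1 := by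
      ext x
      simp [PadicInt.mem_subring_iff]
    rw [h]
    exact IsUltrametricDist.isOpen_closedBall _ one_ne_zero⟩

instance : MeasurableSpace (AdeleQ p) := borel _

instance : BorelSpace (AdeleQ p) := ⟨rfl⟩

/-- The compact open subring `∏_{ℓ ≠ p} ℤ_ℓ` of `ℚ^(p)`. -/
def integralAdeles : TopologicalSpace.PositiveCompacts (AdeleQ p) where
  carrier := {t | ∀ ℓ, t ℓ ∈ PadicInt.subring (ℓ.1 : ℕ)}
  isCompact' := by
    have : ∀ ℓ : PrimesAway p,
        CompactSpace ↑(PadicInt.subring (ℓ.1 : ℕ) : Set ℚ_[(ℓ.1 : ℕ)]) :=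
      fun ℓ => inferInstanceAs (CompactSpace ℤ_[(ℓ.1 : ℕ)])
    have h := isCompact_range (RestrictedProduct.isEmbedding_structureMap
      (R := fun ℓ : PrimesAway p => ℚ_[(ℓ.1 : ℕ)])
      (A := fun ℓ => (PadicInt.subring (ℓ.1 : ℕ) : Set ℚ_[(ℓ.1 : ℕ)]))
      (𝓕 := Filter.cofinite)).continuous
    rwa [RestrictedProduct.range_structureMap] at h
  interior_nonempty' := by
    have ho : IsOpen {t : AdeleQ p | ∀ ℓ, t ℓ ∈ PadicInt.subring (ℓ.1 : ℕ)} :=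
      RestrictedProduct.isOpen_forall_mem (Fact.out (p := ∀ ℓ : PrimesAway p,
        IsOpen (PadicInt.subring (ℓ.1 : ℕ) : Set ℚ_[(ℓ.1 : ℕ)])))
    exact ⟨0, by rw [ho.interior_eq]; exact fun ℓ => (PadicInt.subring (ℓ.1 : ℕ)).zero_mem⟩

/-- `h^(p)`: the Haar integral on `ℚ^(p)`, normalised so that `∏_{ℓ ≠ p} ℤ_ℓ` has measure `1`. -/
def haarIntegral (g : AdeleQ p → ℤ) : ℝ :=
  ∫ t, (g t : ℝ) ∂(MeasureTheory.Measure.addHaarMeasure (integralAdeles p))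

variable {p} {V : Type*} [AddCommGroup V] [Module ℚ V] {L : Submodule ℤ V} [L.IsLattice ℚ]

/-- `f'_{v,w}(t) = f'(w + t v)`. -/
def TestFunction.restrict (f' : TestFunction p L) (v w : V) (t : AdeleQ p) : ℤ :=
  f'.toFun (line p L v w t)

/-- The vanishing hypothesis for (a non-zero vector) `v`: `h^(p)(f'_{v,w}) = 0` for all `w ∈ V`. -/
def TestFunction.VanishingHypothesis (f' : TestFunction p L) (v : V) : Prop :=
  ∀ w : V, haarIntegral p (f'.restrict v w) = 0

end Haar

/-! ### Rational cones -/

section Cones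

variable {V : Type*} [AddCommGroup V] [Module ℚ V]

/-- The open cone generated by the `v i`, `i ∈ S`: all `∑ a_i v_i` in `V_ℝ = ℝ ⊗ V` with real
`a_i > 0`. -/
def openCone {ι : Type*} (v : ι → V) (S : Finset ι) : Set (ℝ ⊗[ℚ] V) :=
  {x | ∃ a : ι → ℝ, (∀ i ∈ S, 0 < a i) ∧ x = ∑ i ∈ S, a i ⊗ₜ[ℚ] v i}

/-- `C` is a rational simplicial cone with extremal rays `v_1, …, v_r`: a finite disjoint union of
open cones, each generated by a linearly independent subfamily of the `v_i`, every `v_i` being used.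
A single open cone `C°(v_1, …, v_r)` with `v_1, …, v_r` linearly independent is the basic example;
its union with some of its faces is another one. -/
def IsSimplicialCone {r : ℕ} (v : Fin r → V) (C : Set (ℝ ⊗[ℚ] V)) : Prop :=
  ∃ 𝓢 : Finset (Finset (Fin r)),
    (∀ S ∈ 𝓢, LinearIndependent ℚ (fun i : S => v i)) ∧
    (∀ S ∈ 𝓢, ∀ T ∈ 𝓢, S ≠ T → Disjoint (openCone v S) (openCone v T)) ∧
    (∀ i, ∃ S ∈ 𝓢, i ∈ S) ∧
    C = ⋃ S ∈ 𝓢, openCone v S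

end Cones

/-! ### Generating functions -/

section GeneratingFunctions

/-- The multiplicative set generated by the `1 - q^v`, `0 ≠ v ∈ M`, in `ℚ[q^v]_{v ∈ M}`. -/
def qDenominators (M : Type*) [AddCommGroup M] : Submonoid (AddMonoidAlgebra ℚ M) :=
  Submonoid.closure {d | ∃ v : M, v ≠ 0 ∧ d = 1 - AddMonoidAlgebra.single v 1}

/-- The localization of `ℚ[q^v]_{v ∈ M}` at the multiplicative set generated by the `1 - q^v`,
`0 ≠ v ∈ M`. -/
abbrev QLoc (M : Type*) [AddCommGroup M] : Type _ := Localization (qDenominators M)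

variable {M : Type*} [AddCommGroup M]

/-- The coefficients of the product of `D ∈ ℚ[q^v]` with the formal series `∑ F(v) q^v`. -/
def mulSeries (D : AddMonoidAlgebra ℚ M) (F : M → ℚ) (w : M) : ℚ :=
  D.coeff.sum fun u c => c * F (w - u)

/-- `g = N / D` is the rational function in the `q^v` with `q`-expansion `∑ F(v) q^v`, i.e.
`D · ∑ F(v) q^v = N` as formal series. -/
def IsRationalForm (F : M → ℚ) (g : QLoc M) : Prop :=
  ∃ (N : AddMonoidAlgebra ℚ M) (D : qDenominators M),
    (∀ w, mulSeries (D : AddMonoidAlgebra ℚ M) F w = N.coeff w) ∧ g = Localization.mk N D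

theorem mulSeries_add (D E : AddMonoidAlgebra ℚ M) (F : M → ℚ) (w : M) :
    mulSeries (D + E) F w = mulSeries D F w + mulSeries E F w := by
  unfold mulSeries
  rw [AddMonoidAlgebra.coeff_add]
  exact Finsupp.sum_add_index' (fun _ => zero_mul _) (fun _ _ _ => add_mul _ _ _)

theorem mulSeries_single (u : M) (c : ℚ) (F : M → ℚ) (w : M) :
    mulSeries (AddMonoidAlgebra.single u c) F w = c * F (w - u) := by
  unfold mulSeries
  rw [AddMonoidAlgebra.coeff_single]
  exact Finsupp.sum_single_index (zero_mul _)

theorem mulSeries_zero (F : M → ℚ) (w : M) : mulSeries 0 F w = 0 := by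
  simp [mulSeries]

theorem mulSeries_mul (D E : AddMonoidAlgebra ℚ M) (F : M → ℚ) :
    mulSeries (D * E) F = mulSeries D (mulSeries E F) := by
  funext w
  induction D using AddMonoidAlgebra.induction_linear with
  | zero => rw [zero_mul, mulSeries_zero, mulSeries_zero]
  | add x y hx hy => rw [add_mul, mulSeries_add, mulSeries_add, hx, hy]
  | single u c =>
    rw [mulSeries_single]
    induction E using AddMonoidAlgebra.induction_linear with
    | zero => rw [mul_zero, mulSeries_zero, mulSeries_zero, mul_zero]
    | add x y hx hy => rw [mul_add, mulSeries_add, mulSeries_add, hx, hy, mul_add]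
    | single u' c' =>
      rw [AddMonoidAlgebra.single_mul_single, mulSeries_single, mulSeries_single, mul_assoc,
        sub_sub]

theorem mulSeries_coeff (D N : AddMonoidAlgebra ℚ M) (w : M) :
    mulSeries D (fun x => N.coeff x) w = (D * N).coeff w := by
  induction D using AddMonoidAlgebra.induction_linear with
  | zero => simp [mulSeries_zero]
  | add x y hx hy => rw [add_mul, mulSeries_add, hx, hy]; simp
  | single u c =>
    rw [mulSeries_single, AddMonoidAlgebra.coeff_single_mul_apply, sub_eq_neg_add]

/-- A series has at most one rational form. -/
theorem IsRationalForm.unique {F : M → ℚ} {g g' : QLoc M} (h : IsRationalForm F g)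
    (h' : IsRationalForm F g') : g = g' := by
  obtain ⟨N, D, hN, rfl⟩ := h
  obtain ⟨N', D', hN', rfl⟩ := h'
  have e : mulSeries (D : AddMonoidAlgebra ℚ M) F = fun x => N.coeff x := funext hN
  have e' : mulSeries (D' : AddMonoidAlgebra ℚ M) F = fun x => N'.coeff x := funext hN'
  rw [Localization.mk_eq_mk_iff, Localization.r_iff_exists]
  refine ⟨1, ?_⟩
  congr 1
  refine AddMonoidAlgebra.coeff_injective (Finsupp.ext fun w => ?_)
  rw [← mulSeries_coeff, ← mulSeries_coeff, ← e, ← e', ← mulSeries_mul, ← mulSeries_mul, mul_comm]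

/-- The value of `N ∈ ℚ[q^v]` when `q^v` is replaced by `χ v`. -/
def evalAt (χ : Multiplicative M →* ℂ) (N : AddMonoidAlgebra ℚ M) : ℂ :=
  N.coeff.sum fun u c => (c : ℂ) * χ (.ofAdd u)

/-- Compatibility with convergent series: if `∑ F(v) q^v` converges to `s` at the point `χ`
(e.g. `χ v = exp (2 π i λ(v))`), then `s` is the value `N(χ) / D(χ)` of its rational form,
as soon as `D(χ) ≠ 0`. -/
theorem evalAt_mul_of_hasSum {F : M → ℚ} {N D : AddMonoidAlgebra ℚ M}
    (h : ∀ w, mulSeries D F w = N.coeff w) (χ : Multiplicative M →* ℂ) {s : ℂ}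
    (hs : HasSum (fun v => (F v : ℂ) * χ (.ofAdd v)) s) : evalAt χ D * s = evalAt χ N := by
  have h1 : HasSum (fun w => (mulSeries D F w : ℂ) * χ (.ofAdd w)) (evalAt χ D * s) := by
    clear h
    induction D using AddMonoidAlgebra.induction_linear with
    | zero => simp [mulSeries_zero, evalAt, hasSum_zero]
    | add x y hx hy =>
      have e : evalAt χ (x + y) = evalAt χ x + evalAt χ y := by
        unfold evalAt
        rw [AddMonoidAlgebra.coeff_add]
        exact Finsupp.sum_add_index' (by simp) (fun _ _ _ => by push_cast; ring)
      rw [e, add_mul]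
      refine (hx.add hy).congr_fun ?_
      intro w
      rw [mulSeries_add]
      push_cast
      ring
    | single u c =>
      have e : evalAt χ (AddMonoidAlgebra.single u c) = c * χ (.ofAdd u) := by
        unfold evalAt
        rw [AddMonoidAlgebra.coeff_single]
        exact Finsupp.sum_single_index (by simp)
      rw [e]
      have := ((Equiv.subRight u).hasSum_iff.2 hs).mul_left ((c : ℂ) * χ (.ofAdd u))
      refine this.congr_fun ?_
      intro w
      have hw : χ (.ofAdd w) = χ (.ofAdd u) * χ (.ofAdd (w - u)) := by
        rw [← map_mul, ← ofAdd_add, add_sub_cancel]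
      rw [mulSeries_single, hw]
      simp
      ring
  simp_rw [h] at h1
  refine h1.unique (hasSum_sum_of_ne_finset_zero fun w hw => ?_)
  rw [Finsupp.notMem_support_iff.1 hw]
  simp

end GeneratingFunctions

/-! ### Pseudo-measures -/

section PseudoMeasures

variable (p : ℕ) [Fact p.Prime] {V : Type*} [AddCommGroup V] [Module ℚ V]
  (L : Submodule ℤ V) [L.IsLattice ℚ]

/-- The Dirac measure `δ_v` on `L_p`, for `v ∈ L`. -/
def diracL (v : L) : PadicMeasure p (Lloc p L) :=
  AbstractMeasure.dirac ℚ_[p] (latticeToLoc p L v)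

/-- The multiplicative set generated by the `1 - δ_v`, `0 ≠ v ∈ L`, in `ℳ(L_p)`. -/
def diracDenominators : Submonoid (PadicMeasure p (Lloc p L)) :=
  Submonoid.closure {d | ∃ v : L, v ≠ 0 ∧ d = 1 - diracL p L v}

/-- The ring of pseudo-measures: the localization of `ℳ(L_p)` at the multiplicative set generated
by the `1 - δ_v`, `0 ≠ v ∈ L`. -/
abbrev PseudoMeasure : Type _ := Localization (diracDenominators p L)

/-- `v ↦ δ_v` as a monoid homomorphism. -/
def diracHom : Multiplicative L →* PadicMeasure p (Lloc p L) where
  toFun v := diracL p L v.toAdd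
  map_one' := by
    rw [toAdd_one, diracL, latticeToLoc_zero]
    rfl
  map_mul' v w := by
    rw [toAdd_mul, diracL, latticeToLoc_add, dirac_add]
    rfl

/-- The ring homomorphism `φ : ℚ[q^v]_{v ∈ L} → ℳ(L_p)` with `φ(q^v) = δ_v`. -/
def phi : AddMonoidAlgebra ℚ L →+* PadicMeasure p (Lloc p L) :=
  AddMonoidAlgebra.liftNCRingHom (constHom.comp (Rat.castHom ℚ_[p])) (diracHom p L)
    fun _ _ => Commute.all _ _

theorem phi_single (v : L) : phi p L (AddMonoidAlgebra.single v 1) = diracL p L v := by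
  rw [phi, AddMonoidAlgebra.liftNCRingHom_single, map_one, one_mul]
  rfl

theorem qDenominators_le : qDenominators L ≤ (diracDenominators p L).comap (phi p L) := by
  rw [qDenominators, Submonoid.closure_le]
  rintro _ ⟨v, hv, rfl⟩
  refine Submonoid.subset_closure ⟨v, hv, ?_⟩
  rw [map_sub, map_one, phi_single]

/-- The homomorphism induced by `φ` on localizations. -/
def phiLoc : QLoc L →+* PseudoMeasure p L :=
  IsLocalization.map (PseudoMeasure p L) (phi p L) (qDenominators_le p L)

variable {p L}

open scoped Classical in
/-- The coefficients of `G_{C,f} = ∑_{v ∈ C} f(v) q^v`, where `f = f' ⊗ [L_p]` (supported on `L`). -/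
def genCoeff (f' : TestFunction p L) (C : Set (ℝ ⊗[ℚ] V)) (v : L) : ℚ :=
  if (1 : ℝ) ⊗ₜ[ℚ] (v : V) ∈ C then (f'.tensorLp (v : V) : ℚ) else 0

/-- `μ` is the pseudo-measure `μ_{f',C}`: it is `φ(G_{C,f})`, where the series
`G_{C,f} = ∑_{v ∈ C} f(v) q^v` is regarded as a rational function in the `q^v`. -/
def IsPseudoMeasureOf (f' : TestFunction p L) (C : Set (ℝ ⊗[ℚ] V)) (μ : PseudoMeasure p L) : Prop :=
  ∃ G : QLoc L, IsRationalForm (genCoeff f' C) G ∧ μ = phiLoc p L G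

theorem IsPseudoMeasureOf.unique {f' : TestFunction p L} {C : Set (ℝ ⊗[ℚ] V)}
    {μ μ' : PseudoMeasure p L} (h : IsPseudoMeasureOf f' C μ) (h' : IsPseudoMeasureOf f' C μ') :
    μ = μ' := by
  obtain ⟨G, hG, rfl⟩ := h
  obtain ⟨G', hG', rfl⟩ := h'
  rw [hG.unique hG']

/-- A pseudo-measure is a measure if it comes from `ℳ(L_p)`. -/
def PseudoMeasure.IsMeasure (μ : PseudoMeasure p L) : Prop :=
  ∃ ν : PadicMeasure p (Lloc p L), algebraMap _ (PseudoMeasure p L) ν = μ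

end PseudoMeasures

end ShintaniMeasure

end

open ShintaniMeasure

/-! Splitting `C` into open cones reduces the claim to one cone with rays `v_i`, `i ∈ S`, linearly
independent. Let `u_i = c_i v_i`, `c_i > 0`, generate `L ∩ ℚ v_i`. On the compact group `∏ L_ℓ` the
locally constant function `f'` has a period `m`, and `m` can be taken prime to `p` because only the
primes `ℓ ≠ p` occur (`TestFunction.exists_period`).

For `x ∈ L` the function `t ↦ f'(x + t v_i)` takes the constant value `f(x + j u_i)` on the box `j
c_i + c_i m ∏ ℤ_ℓ`, `0 ≤ j < m`. These boxes are disjoint and have the same Haar measure, and `f' ∈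
𝒮^(p)(L)` forces the function to vanish outside them. The vanishing hypothesis therefore becomes
`∑_{j<m} f(x + j u_i) = 0` (`TestFunction.sum_tensorLp_eq_zero`).

Multiply `G_{C,f}` by all the geometric sums `1 + q^{u_i} + ⋯ + q^{(m-1)u_i}`. A coefficient far
from the wall opposite to `v_i` is built from complete sums of the above kind, so it is zero; the
product is a Laurent polynomial (`isMeasureSeries_openCone`). Thus `G_{C,f}` has only geometric sums
of length `m` as denominators.

Finally `φ` sends these sums to units of `ℳ(L_p)` (`isUnit_geom_sum_dirac`). Such a sum `g` is
coprime, with coefficients of norm at most 1, to `δ_{p^n u} - 1` for every `n`, and `δ_{p^n u}`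
tends strongly to 1; so convolution by `g` is bounded below with dense range, hence invertible. -/

open scoped TensorProduct RestrictedProduct

noncomputable section

namespace ShintaniMeasure

/-! ### Units in the convolution ring -/

/-- Geometric sums of lengths `m` and `n` are coprime if `m` and `n` are. -/
theorem isCoprime_geom_sum {R : Type*} [CommRing R] (x : R) {m n : ℕ} (h : m.Coprime n) :
    IsCoprime (∑ j ∈ Finset.range m, x ^ j) (∑ j ∈ Finset.range n, x ^ j) := by
  induction m, n using Nat.gcd.induction with
  | H0 n =>
    have : n = 1 := by simpa using h
    subst this
    simpa using isCoprime_one_right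
  | H1 m n hm ih =>
    have h' : (n % m).Coprime m := by
      rwa [Nat.Coprime, ← Nat.gcd_rec]
    have := (ih h').symm
    -- Euclid's algorithm on the lengths: modulo the sum of length `m`, the sum of length `n` is the
    -- sum of length `n % m`.
    have e : ∑ j ∈ Finset.range n, x ^ j = ∑ j ∈ Finset.range (n % m), x ^ j +
        (∑ j ∈ Finset.range m, x ^ j) *
          (x ^ (n % m) * ∑ k ∈ Finset.range (n / m), (x ^ m) ^ k) := by
      have key : ∀ k, ∑ j ∈ Finset.range (n % m + m * k), x ^ j =
          ∑ j ∈ Finset.range (n % m), x ^ j + (∑ j ∈ Finset.range m, x ^ j) *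
          (x ^ (n % m) * ∑ k ∈ Finset.range k, (x ^ m) ^ k) := by
        intro k
        induction k with
        | zero => simp
        | succ k ihk =>
          rw [mul_add, mul_one, ← add_assoc, Finset.sum_range_add, ihk, Finset.sum_range_succ _ k]
          have : ∑ j ∈ Finset.range m, x ^ (n % m + m * k + j) =
              x ^ (n % m + m * k) * ∑ j ∈ Finset.range m, x ^ j := by
            rw [Finset.mul_sum]
            exact Finset.sum_congr rfl fun j _ => pow_add _ _ _
          rw [this, pow_add, pow_mul]
          ring
      rw [← key, Nat.mod_add_div]
    rw [e]
    exact this.add_mul_left_right _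

section Measures

variable {p : ℕ} [Fact p.Prime] {G : Type*} [TopologicalSpace G] [AddCommGroup G]
  [IsTopologicalAddGroup G] [CompactSpace G]

/-- The operator `f ↦ (y ↦ ∫ f (x + y) dμ(x))` on continuous functions. -/
def convOp (μ : PadicMeasure p G) : C(G, ℚ_[p]) →L[ℚ_[p]] C(G, ℚ_[p]) :=
  (AbstractMeasure.contractFstCLM μ).comp ((addMap G).compCLM ℚ_[p] ℚ_[p])

theorem convOp_apply (μ : PadicMeasure p G) (f : C(G, ℚ_[p])) (y : G) :
    convOp μ f y = μ ⟨fun x => f (x + y), by fun_prop⟩ := rfl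

theorem norm_comp_add_le (f : C(G, ℚ_[p])) (y : G) :
    ‖(⟨fun x => f (x + y), by fun_prop⟩ : C(G, ℚ_[p]))‖ ≤ ‖f‖ :=
  (ContinuousMap.norm_le _ (norm_nonneg f)).2 fun x => f.norm_coe_le_norm (x + y)

/-- Translations by a sequence tending to `0` tend strongly to the identity. -/
theorem tendsto_convOp_dirac {s : ℕ → G} (hs : Filter.Tendsto s Filter.atTop (nhds 0))
    (f : C(G, ℚ_[p])) :
    Filter.Tendsto (fun n => convOp (AbstractMeasure.dirac ℚ_[p] (s n)) f) Filter.atTop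
      (nhds f) := by
  -- Currying makes `x ↦ f(x + ·)` continuous for the compact-open topology, which is that of
  -- uniform convergence because `G` is compact.
  let F : C(G, C(G, ℚ_[p])) := (f.comp (addMap G)).curry
  have h := (F.continuous.tendsto 0).comp hs
  have h0 : F 0 = f := by
    ext y
    exact congrArg f (zero_add y)
  rw [h0] at h
  exact h

variable [T2Space G] [TotallyDisconnectedSpace G]

theorem mul_apply (μ ν : PadicMeasure p G) (f : C(G, ℚ_[p])) : (μ * ν) f = ν (convOp μ f) := rfl

/-- The operators `convOp` make the continuous functions a module over the convolution ring, and `μ`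
is recovered from `convOp μ` by evaluation at `0`. Inverting a measure thus reduces to inverting its
operator. -/
theorem convOp_mul (μ ν : PadicMeasure p G) (f : C(G, ℚ_[p])) :
    convOp (μ * ν) f = convOp ν (convOp μ f) := by
  ext y
  rw [convOp_apply, mul_apply, convOp_apply]
  congr 1
  ext z
  change μ _ = μ _
  congr 1
  ext x
  exact congrArg f (add_assoc x z y)

theorem convOp_add (μ ν : PadicMeasure p G) (f : C(G, ℚ_[p])) :
    convOp (μ + ν) f = convOp μ f + convOp ν f := rfl

theorem convOp_sub (μ ν : PadicMeasure p G) (f : C(G, ℚ_[p])) :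
    convOp (μ - ν) f = convOp μ f - convOp ν f := rfl

theorem convOp_one (f : C(G, ℚ_[p])) : convOp 1 f = f := by
  ext y
  rw [convOp_apply]
  exact congrArg f (zero_add y)

theorem dirac_nsmul (u : G) (n : ℕ) : (AbstractMeasure.dirac ℚ_[p] (n • u) : PadicMeasure p G) =
    AbstractMeasure.dirac ℚ_[p] u ^ n := by
  induction n with
  | zero => rw [zero_smul, pow_zero, one_def]
  | succ n ih => rw [add_smul, one_smul, dirac_add, ih, pow_succ]

variable (p G) in
/-- The measures of norm at most `1`. -/
def integralMeasures : Subring (PadicMeasure p G) where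
  carrier := {μ | ∀ f, ‖μ f‖ ≤ ‖f‖}
  zero_mem' f := by
    change ‖(0 : ℚ_[p])‖ ≤ _
    simp
  one_mem' f := f.norm_coe_le_norm 0
  add_mem' {μ ν} hμ hν f :=
    (IsUltrametricDist.norm_add_le_max (μ f) (ν f)).trans (max_le (hμ f) (hν f))
  neg_mem' {μ} hμ f := by
    change ‖-(μ f)‖ ≤ _
    rw [norm_neg]
    exact hμ f
  mul_mem' {μ ν} hμ hν f := by
    rw [mul_apply]
    refine (hν _).trans ((ContinuousMap.norm_le _ (norm_nonneg f)).2 fun y => ?_)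
    exact (hμ _).trans (norm_comp_add_le f y)

theorem dirac_mem_integralMeasures (u : G) :
    (AbstractMeasure.dirac ℚ_[p] u : PadicMeasure p G) ∈ integralMeasures p G :=
  fun f => f.norm_coe_le_norm u

theorem norm_convOp_le {μ : PadicMeasure p G} (hμ : μ ∈ integralMeasures p G) (f : C(G, ℚ_[p])) :
    ‖convOp μ f‖ ≤ ‖f‖ :=
  (ContinuousMap.norm_le _ (norm_nonneg f)).2 fun y => (hμ _).trans (norm_comp_add_le f y)

theorem constHom_mem_integralMeasures {c : ℚ_[p]} (hc : ‖c‖ ≤ 1) :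
    (constHom c : PadicMeasure p G) ∈ integralMeasures p G := by
  intro f
  change ‖c * f 0‖ ≤ _
  rw [norm_mul]
  exact (mul_le_of_le_one_left (norm_nonneg _) hc).trans (f.norm_coe_le_norm 0)

/-- For `m` prime to `p`, `1 + δ_u + ⋯ + δ_{(m-1)u}` is
coprime to `δ_{p^n u} - 1` among the integral measures. -/
theorem exists_bezout_dirac (u : G) {m : ℕ} (hm : m.Coprime p) (n : ℕ) :
    ∃ a ∈ integralMeasures p G, ∃ b ∈ integralMeasures p G,
      a * (∑ j ∈ Finset.range m, AbstractMeasure.dirac ℚ_[p] u ^ j) +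
        b * (AbstractMeasure.dirac ℚ_[p] (p ^ n • u) - 1) = (1 : PadicMeasure p G) := by
  let d : integralMeasures p G := ⟨AbstractMeasure.dirac ℚ_[p] u, dirac_mem_integralMeasures u⟩
  have hmu : ‖(m : ℚ_[p])‖ = 1 := by
    rw [Padic.norm_natCast_eq_one_iff]
    exact hm.symm
  have hm0 : (m : ℚ_[p]) ≠ 0 := fun h => by simp [h] at hmu
  let c : integralMeasures p G := ⟨constHom ((m : ℚ_[p])⁻¹),
    constHom_mem_integralMeasures (by rw [norm_inv, hmu, inv_one])⟩
  have hc : c * (m : integralMeasures p G) = 1 := by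
    apply Subtype.ext
    change constHom ((m : ℚ_[p])⁻¹) * ((m : integralMeasures p G) : PadicMeasure p G) = 1
    rw [Subring.coe_natCast, ← map_natCast (constHom : ℚ_[p] →+* PadicMeasure p G), ← map_mul,
      inv_mul_cancel₀ hm0, map_one]
  -- Modulo `d - 1` the sum is the integer `m`, a unit among the integral measures since `m` is
  -- prime to `p`.
  have h1 : IsCoprime (∑ j ∈ Finset.range m, d ^ j) (d - 1) := by
    have hdvd : d - 1 ∣ ∑ j ∈ Finset.range m, d ^ j - (m : integralMeasures p G) := by
      have : ∑ j ∈ Finset.range m, d ^ j - (m : integralMeasures p G) =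
          ∑ j ∈ Finset.range m, (d ^ j - 1) := by simp
      rw [this]
      exact Finset.dvd_sum fun j _ => sub_one_dvd_pow_sub_one d j
    obtain ⟨e, he⟩ := hdvd
    exact ⟨c, -c * e, by linear_combination hc + c * he⟩
  -- The sum is also coprime to the geometric sum of length `p ^ n`, hence to the product of that
  -- sum with `d - 1`, which is `d ^ (p ^ n) - 1`.
  have h2 := h1.mul_right (isCoprime_geom_sum d (hm.pow_right n))
  rw [mul_geom_sum] at h2
  obtain ⟨a, b, hab⟩ := h2
  refine ⟨a, a.2, b, b.2, ?_⟩
  have := congrArg (Subtype.val) hab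
  rw [dirac_nsmul]
  simpa [d] using this

/-- For `m` prime to `p` and `u` topologically `p`-nilpotent, the measure
`1 + δ_u + ⋯ + δ_{(m-1)u}` is invertible. -/
theorem isUnit_geom_sum_dirac {u : G}
    (hu : Filter.Tendsto (fun n : ℕ => p ^ n • u) Filter.atTop (nhds 0))
    {m : ℕ} (hm : m.Coprime p) :
    IsUnit (∑ j ∈ Finset.range m, (AbstractMeasure.dirac ℚ_[p] u : PadicMeasure p G) ^ j) := by
  set g : PadicMeasure p G := ∑ j ∈ Finset.range m, AbstractMeasure.dirac ℚ_[p] u ^ j with hg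
  -- The Bézout relation says that `a` inverts `g` up to `b (δ_{p^n u} - 1)`. This error is small on
  -- a given `f` for large `n`, because `b` has norm at most 1 whatever `n` is; `a` depends on `f`
  -- and `ε`, so no single approximate inverse is claimed.
  have hsmall : ∀ (f : C(G, ℚ_[p])) (ε : ℝ), 0 < ε → ∃ a ∈ integralMeasures p G,
      ‖f - convOp a (convOp g f)‖ < ε := by
    intro f ε hε
    obtain ⟨n, hn⟩ := ((tendsto_convOp_dirac hu f).eventually (Metric.ball_mem_nhds f hε)).exists
    obtain ⟨a, ha, b, hb, hab⟩ := exists_bezout_dirac (p := p) u hm n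
    refine ⟨a, ha, ?_⟩
    have e : f - convOp a (convOp g f) =
        convOp b (convOp (AbstractMeasure.dirac ℚ_[p] (p ^ n • u)) f - f) := by
      have h1 := congrArg (fun μ => convOp μ f) hab
      simp only [convOp_one, convOp_add, mul_comm a, convOp_mul, mul_comm b, convOp_sub] at h1
      rw [sub_eq_iff_eq_add', h1]
    rw [e]
    exact (norm_convOp_le hb _).trans_lt (by simpa [dist_eq_norm] using hn)
  have hbound : ∀ f : C(G, ℚ_[p]), ‖f‖ ≤ ‖convOp g f‖ := by
    intro f
    refine le_of_forall_pos_le_add fun ε hε => ?_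
    obtain ⟨a, ha, h⟩ := hsmall f ε hε
    calc ‖f‖ = ‖(f - convOp a (convOp g f)) + convOp a (convOp g f)‖ := by rw [sub_add_cancel]
      _ ≤ ‖f - convOp a (convOp g f)‖ + ‖convOp a (convOp g f)‖ := norm_add_le _ _
      _ ≤ ‖convOp g f‖ + ε := by linarith [norm_convOp_le ha (convOp g f)]
  have hanti : AntilipschitzWith 1 (convOp g) :=
    ContinuousLinearMap.antilipschitz_of_bound _ fun f => by simpa using hbound f
  have hclosed : IsClosed (Set.range (convOp g)) :=
    hanti.isClosed_range (convOp g).uniformContinuous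
  -- The range is closed by the lower bound, and dense because `g` applied to `convOp a f` is close
  -- to `f`.
  have hsurj : Function.Surjective (convOp g) := by
    rw [← Set.range_eq_univ, ← hclosed.closure_eq, Set.eq_univ_iff_forall]
    intro f
    rw [Metric.mem_closure_iff]
    intro ε hε
    obtain ⟨a, -, h⟩ := hsmall f ε hε
    refine ⟨_, ⟨convOp a f, rfl⟩, ?_⟩
    rwa [dist_eq_norm, ← convOp_mul, mul_comm, convOp_mul]
  let e := ContinuousLinearEquiv.ofBijective (convOp g)
    (LinearMap.ker_eq_bot.2 hanti.injective) (LinearMap.range_eq_top.2 hsurj)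
  -- The inverse operator followed by evaluation at `0`.
  let ν : PadicMeasure p G := AbstractMeasure.toCLMEquiv.symm
    ((ContinuousMap.evalCLM ℚ_[p] (0 : G)).comp (e.symm : C(G, ℚ_[p]) →L[ℚ_[p]] C(G, ℚ_[p])))
  refine IsUnit.of_mul_eq_one ν (DFunLike.ext _ _ fun f => ?_)
  change e.symm (e f) 0 = f 0
  rw [e.symm_apply_apply]

end Measures

/-! ### Series whose rational form is a measure -/

section

variable {M : Type*} [AddCommGroup M]

theorem mulSeries_add_right (D : AddMonoidAlgebra ℚ M) (F F' : M → ℚ) :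
    mulSeries D (F + F') = mulSeries D F + mulSeries D F' := by
  funext w
  simp only [mulSeries, Finsupp.sum, Pi.add_apply, mul_add, Finset.sum_add_distrib]

theorem mulSeries_one (F : M → ℚ) : mulSeries 1 F = F := by
  funext w
  rw [AddMonoidAlgebra.one_def, mulSeries_single, one_mul, sub_zero]

/-- The geometric sum `1 + q^u + ⋯ + q^{(m-1)u}`. -/
def qGeomSum (u : M) (m : ℕ) : AddMonoidAlgebra ℚ M :=
  ∑ j ∈ Finset.range m, AddMonoidAlgebra.single (j • u) 1

theorem qGeomSum_eq (u : M) (m : ℕ) :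
    qGeomSum u m = ∑ j ∈ Finset.range m, AddMonoidAlgebra.single u (1 : ℚ) ^ j := by
  simp [qGeomSum, AddMonoidAlgebra.single_pow]

theorem one_sub_mul_qGeomSum (u : M) (m : ℕ) :
    (1 - AddMonoidAlgebra.single u 1) * qGeomSum u m =
      1 - AddMonoidAlgebra.single (m • u) (1 : ℚ) := by
  rw [qGeomSum_eq, mul_neg_geom_sum, AddMonoidAlgebra.single_pow, one_pow]

theorem mulSeries_sum {ι : Type*} (s : Finset ι) (D : ι → AddMonoidAlgebra ℚ M) (F : M → ℚ)
    (w : M) : mulSeries (∑ i ∈ s, D i) F w = ∑ i ∈ s, mulSeries (D i) F w := by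
  classical
  induction s using Finset.induction_on with
  | empty => simp [mulSeries_zero]
  | insert a s ha ih => rw [Finset.sum_insert ha, Finset.sum_insert ha, mulSeries_add, ih]

theorem mulSeries_qGeomSum (u : M) (m : ℕ) (F : M → ℚ) (w : M) :
    mulSeries (qGeomSum u m) F w = ∑ j ∈ Finset.range m, F (w - j • u) := by
  simp only [qGeomSum, mulSeries_sum, mulSeries_single, one_mul]

end

section

variable {p : ℕ} [Fact p.Prime] {V : Type*} [AddCommGroup V] [Module ℚ V]
  {L : Submodule ℤ V}

theorem tendsto_pow_smul_latticeToLoc (u : L) :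
    Filter.Tendsto (fun n : ℕ => p ^ n • latticeToLoc p L u) Filter.atTop (nhds 0) := by
  rw [tendsto_subtype_rng]
  have h : Filter.Tendsto (fun n : ℕ => (p : ℚ_[p]) ^ n) Filter.atTop (nhds 0) :=
    tendsto_pow_atTop_nhds_zero_of_norm_lt_one Padic.norm_p_lt_one
  have h2 := h.smul_const (toLoc p (u : V))
  rw [zero_smul] at h2
  refine h2.congr fun n => ?_
  rw [Submodule.coe_smul_of_tower, ← Nat.cast_pow, Nat.cast_smul_eq_nsmul]
  rfl

variable [L.IsLattice ℚ]

variable (p) in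
/-- The series `∑ F(v) q^v` has a rational form `N / D` whose image under `φ` is a measure. -/
def IsMeasureSeries (F : L → ℚ) : Prop :=
  ∃ (N : AddMonoidAlgebra ℚ L) (D : qDenominators L) (ν : PadicMeasure p (Lloc p L)),
    mulSeries (D : AddMonoidAlgebra ℚ L) F = N.coeff ∧ phi p L N = phi p L D * ν

theorem IsMeasureSeries.add {F F' : L → ℚ} (h : IsMeasureSeries p F)
    (h' : IsMeasureSeries p F') : IsMeasureSeries p (F + F') := by
  obtain ⟨N, D, ν, h1, h2⟩ := h
  obtain ⟨N', D', ν', h1', h2'⟩ := h'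
  refine ⟨D' * N + D * N', D * D', ν + ν', ?_, ?_⟩
  · funext w
    rw [mulSeries_add_right, Submonoid.coe_mul, Pi.add_apply, mulSeries_mul _ _ F', h1', mul_comm,
      mulSeries_mul, h1, AddMonoidAlgebra.coeff_add, Finsupp.add_apply]
    congr 1
    · exact mulSeries_coeff _ _ _
    · exact mulSeries_coeff _ _ _
  · rw [map_add, map_mul, map_mul, h2, h2', Submonoid.coe_mul, map_mul]
    ring

theorem isMeasureSeries_of_finite_support {F : L → ℚ} (h : F.support.Finite) :
    IsMeasureSeries p F := by
  refine ⟨AddMonoidAlgebra.ofCoeff (Finsupp.ofSupportFinite F h), 1,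
    phi p L (AddMonoidAlgebra.ofCoeff (Finsupp.ofSupportFinite F h)), ?_, (by rw [Submonoid.coe_one, map_one, one_mul])⟩
  rw [Submonoid.coe_one, mulSeries_one]
  rfl

theorem isMeasureSeries_sum {ι : Type*} (s : Finset ι) (F : ι → L → ℚ)
    (h : ∀ i ∈ s, IsMeasureSeries p (F i)) : IsMeasureSeries p (∑ i ∈ s, F i) := by
  refine Finset.sum_induction _ _ (fun _ _ => IsMeasureSeries.add) ?_ h
  exact isMeasureSeries_of_finite_support (by simp)

theorem isUnit_phi_qGeomSum (u : L) {m : ℕ} (hm : m.Coprime p) :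
    IsUnit (phi p L (qGeomSum u m)) := by
  rw [qGeomSum_eq, map_sum]
  simp only [map_pow, phi_single]
  exact isUnit_geom_sum_dirac (tendsto_pow_smul_latticeToLoc u) hm

/-- Division by a geometric sum is harmless since `φ` makes it a unit. The sum itself need not be an
admissible denominator, so numerator and denominator are both multiplied by `1 - q^u`, which
completes it to `1 - q^{mu}`. -/
theorem IsMeasureSeries.of_mulSeries_qGeomSum {F : L → ℚ} {u : L} (hu : u ≠ 0) {m : ℕ}
    (hm : m.Coprime p) (hm0 : m ≠ 0) (h : IsMeasureSeries p (mulSeries (qGeomSum u m) F)) :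
    IsMeasureSeries p F := by
  obtain ⟨N, D, ν, h1, h2⟩ := h
  obtain ⟨g, hg⟩ := isUnit_phi_qGeomSum (p := p) u hm
  have hd : 1 - AddMonoidAlgebra.single (m • u) (1 : ℚ) ∈ qDenominators L := by
    refine Submonoid.subset_closure ⟨m • u, ?_, rfl⟩
    intro h
    have h' : (m : ℚ) • (u : V) = 0 := by
      rw [Nat.cast_smul_eq_nsmul]
      exact congrArg Subtype.val h
    rcases smul_eq_zero.1 h' with h' | h'
    · exact hm0 (by exact_mod_cast h')
    · exact hu (Subtype.ext h')
  refine ⟨(1 - AddMonoidAlgebra.single u 1) * N, D * ⟨_, hd⟩, ↑g⁻¹ * ν, ?_, ?_⟩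
  · rw [Submonoid.coe_mul]
    dsimp only
    rw [← one_sub_mul_qGeomSum, mul_left_comm, mulSeries_mul, mulSeries_mul, h1]
    exact funext fun w => mulSeries_coeff _ _ _
  · rw [Submonoid.coe_mul]
    dsimp only
    rw [← one_sub_mul_qGeomSum, map_mul, map_mul, map_mul, h2, ← hg]
    calc phi p L (1 - AddMonoidAlgebra.single u 1) * (phi p L D * ν) =
        phi p L (1 - AddMonoidAlgebra.single u 1) * (phi p L D * ν) * (g * ↑g⁻¹) := by
          rw [Units.mul_inv, mul_one]
      _ = _ := by ring

theorem IsMeasureSeries.of_mulSeries_prod {ι : Type*} (S : Finset ι) {u : ι → L}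
    (hu : ∀ i ∈ S, u i ≠ 0) {m : ℕ} (hm : m.Coprime p) (hm0 : m ≠ 0) {F : L → ℚ}
    (h : IsMeasureSeries p (mulSeries (∏ i ∈ S, qGeomSum (u i) m) F)) : IsMeasureSeries p F := by
  classical
  induction S using Finset.induction_on generalizing F with
  | empty => simpa [mulSeries_one] using h
  | insert a S ha ih =>
    rw [Finset.prod_insert ha, mulSeries_mul] at h
    exact ih (fun i hi => hu i (Finset.mem_insert_of_mem hi))
      (h.of_mulSeries_qGeomSum (hu a (Finset.mem_insert_self _ _)) hm hm0)

theorem IsMeasureSeries.exists_isPseudoMeasureOf {f' : TestFunction p L} {C : Set (ℝ ⊗[ℚ] V)}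
    (h : IsMeasureSeries p (genCoeff f' C)) :
    ∃ μ : PseudoMeasure p L, IsPseudoMeasureOf f' C μ ∧ μ.IsMeasure := by
  obtain ⟨N, D, ν, h1, h2⟩ := h
  refine ⟨_, ⟨Localization.mk N D, ⟨N, D, congrFun h1, rfl⟩, rfl⟩, ν, ?_⟩
  rw [phiLoc, Localization.mk_eq_mk', IsLocalization.map_mk', IsLocalization.eq_mk'_iff_mul_eq,
    ← map_mul, h2, mul_comm]

end

/-! ### Periods of test functions -/

section

variable {V : Type*} [AddCommGroup V] [Module ℚ V] {L : Submodule ℤ V}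
  {p : ℕ}

variable (p) in
/-- Translation of `y ∈ V^(p)` by an element of `∏ L_ℓ`. -/
def shift (y : AdeleV p L) (z : ∀ ℓ : PrimesAway p, Lloc (ℓ.1 : ℕ) L) : AdeleV p L :=
  RestrictedProduct.mk (fun ℓ => y ℓ + z ℓ) <| by
    filter_upwards [y.2] with ℓ hy
    exact Submodule.add_mem _ hy (z ℓ).2

/-- The translates all stay in the piece of the restricted product that is integral at each `ℓ`
where `y` is. On that piece the topology is the product topology, so continuity can be checked at
each prime separately. -/
theorem continuous_shift (y : AdeleV p L) : Continuous (shift p y) := by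
  let S : Set (PrimesAway p) := {ℓ | y ℓ ∈ Lloc (ℓ.1 : ℕ) L}
  have hS : Filter.cofinite ≤ Filter.principal S := Filter.le_principal_iff.2 y.2
  let g : (∀ ℓ : PrimesAway p, Lloc (ℓ.1 : ℕ) L) →
      Πʳ ℓ : PrimesAway p, [Vloc (ℓ.1 : ℕ) V, (Lloc (ℓ.1 : ℕ) L : Set (Vloc (ℓ.1 : ℕ) V))]_[
        Filter.principal S] :=
    fun z => RestrictedProduct.mk (fun ℓ => y ℓ + z ℓ)
      (Filter.eventually_principal.2 fun ℓ hy => Submodule.add_mem _ hy (z ℓ).2)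
  have hg : Continuous g := by
    rw [RestrictedProduct.continuous_rng_of_principal_iff_forall]
    intro ℓ
    exact continuous_const.add (continuous_subtype_val.comp (continuous_apply ℓ))
  exact (RestrictedProduct.continuous_inclusion hS).comp hg

variable [L.IsLattice ℚ]

/-- Compactness of `L_ℓ` makes the convergence of `ℓ ^ n • b` to `0` uniform in `b`. -/
theorem exists_pow_smul_mem_of_mem_nhds (ℓ : ℕ) [Fact ℓ.Prime] {t : Set (Lloc ℓ L)}
    (ht : t ∈ nhds 0) : ∃ n : ℕ, ∀ b, ℓ ^ n • b ∈ t := by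
  rw [nhds_subtype, Filter.mem_comap] at ht
  obtain ⟨t', ht', hsub⟩ := ht
  have h := (isCompact_univ (X := Lloc ℓ L)).eventually_forall_of_forall_eventually
    (x₀ := (0 : ℚ_[ℓ])) (P := fun c b => c • (b : Vloc ℓ V) ∈ t') (fun b _ => by
      have hc : Continuous fun z : ℚ_[ℓ] × Lloc ℓ L => z.1 • (z.2 : Vloc ℓ V) :=
        continuous_fst.smul (continuous_subtype_val.comp continuous_snd)
      refine (hc.tendsto (0, b)).eventually ?_
      simpa using ht')
  have h0 : Filter.Tendsto (fun n : ℕ => (ℓ : ℚ_[ℓ]) ^ n) Filter.atTop (nhds 0) :=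
    tendsto_pow_atTop_nhds_zero_of_norm_lt_one Padic.norm_p_lt_one
  obtain ⟨n, hn⟩ := (h0.eventually h).exists
  refine ⟨n, fun b => hsub ?_⟩
  have := hn b trivial
  rw [← Nat.cast_pow, Nat.cast_smul_eq_nsmul] at this
  exact this

/-- A neighbourhood of `0` in the product constrains only finitely many `ℓ ≠ p`; a product of powers
of these primes serves, and is prime to `p`. -/
theorem exists_smul_mem_of_mem_nhds [Fact p.Prime]
    {U : Set (∀ ℓ : PrimesAway p, Lloc (ℓ.1 : ℕ) L)} (hU : U ∈ nhds 0) :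
    ∃ m : ℕ, m ≠ 0 ∧ m.Coprime p ∧ ∀ b, m • b ∈ U := by
  rw [nhds_pi, Filter.mem_pi] at hU
  obtain ⟨I, hI, t, ht, hsub⟩ := hU
  choose n hn using fun ℓ : PrimesAway p => exists_pow_smul_mem_of_mem_nhds (ℓ.1 : ℕ) (ht ℓ)
  refine ⟨∏ ℓ ∈ hI.toFinset, (ℓ.1 : ℕ) ^ n ℓ, ?_, ?_, ?_⟩
  · exact Finset.prod_ne_zero_iff.2 fun ℓ _ => pow_ne_zero _ ℓ.1.2.ne_zero
  · exact Nat.Coprime.prod_left fun ℓ _ =>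
      Nat.Coprime.pow_left _ ((Nat.coprime_primes ℓ.1.2 Fact.out).2 ℓ.2)
  · intro b
    refine hsub fun ℓ hℓ => ?_
    obtain ⟨k, hk⟩ := Finset.dvd_prod_of_mem (fun ℓ : PrimesAway p => (ℓ.1 : ℕ) ^ n ℓ)
      (hI.mem_toFinset.2 hℓ)
    rw [Pi.smul_apply, hk, mul_smul]
    exact hn ℓ _

/-- A continuous function from `∏ L_ℓ` to a discrete space has a period prime to `p`. -/
theorem exists_period [Fact p.Prime] {h : (∀ ℓ : PrimesAway p, Lloc (ℓ.1 : ℕ) L) → ℤ}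
    (hc : Continuous h) :
    ∃ m : ℕ, m ≠ 0 ∧ m.Coprime p ∧ ∀ a b, h (a + m • b) = h a := by
  -- By compactness one neighbourhood of `0` consists of periods valid at all `a` simultaneously.
  have key := isCompact_univ.eventually_forall_of_forall_eventually
    (x₀ := (0 : ∀ ℓ : PrimesAway p, Lloc (ℓ.1 : ℕ) L)) (P := fun b a => h (a + b) = h a)
    (fun a _ => by
      have h1 : Continuous fun z : (∀ ℓ : PrimesAway p, Lloc (ℓ.1 : ℕ) L) ×
          (∀ ℓ : PrimesAway p, Lloc (ℓ.1 : ℕ) L) => h (z.2 + z.1) - h z.2 := by fun_prop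
      have h2 := (h1.tendsto (0, a)).eventually
        (show ∀ᶠ k in nhds _, k = (0 : ℤ) by simp)
      exact h2.mono fun z hz => sub_eq_zero.1 hz)
  obtain ⟨m, hm0, hm, hmem⟩ := exists_smul_mem_of_mem_nhds key
  exact ⟨m, hm0, hm, fun a b => hmem b a trivial⟩

/-- The period depends on the coset `y + ∏ L_ℓ`. The coset of `0` gives the period `m` used for the
whole lattice; other cosets serve to control the support of `f'` along a line. -/
theorem TestFunction.exists_period [Fact p.Prime] (f' : TestFunction p L) (y : AdeleV p L) :
    ∃ m : ℕ, m ≠ 0 ∧ m.Coprime p ∧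
      ∀ a b, f'.toFun (shift p y (a + m • b)) = f'.toFun (shift p y a) :=
  ShintaniMeasure.exists_period (f'.isLocallyConstant.continuous.comp (continuous_shift y))

end

/-! ### Rational approximation of adeles -/

section

/-- A rational number that is integral at every prime is an integer. -/
theorem exists_int_eq_of_norm_le_one (q : ℚ)
    (h : ∀ ℓ : ℕ, [Fact ℓ.Prime] → ‖(q : ℚ_[ℓ])‖ ≤ 1) : ∃ k : ℤ, q = k := by
  suffices q.den = 1 from ⟨q.num, (Rat.den_eq_one_iff q).1 this |>.symm⟩
  by_contra hd
  obtain ⟨ℓ, hℓ, hdvd⟩ := Nat.exists_prime_and_dvd hd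
  have := Fact.mk hℓ
  have h1 : ‖((q.num : ℤ) : ℚ_[ℓ])‖ = 1 := by
    refine le_antisymm (Padic.norm_int_le_one _) (not_lt.1 fun hlt => ?_)
    have := Padic.norm_intCast_lt_one_iff.1 hlt
    exact hℓ.one_lt.ne' (Nat.eq_one_of_dvd_coprimes q.reduced (Int.natCast_dvd.1 this) hdvd)
  have h2 : ‖((q.den : ℕ) : ℚ_[ℓ])‖ < 1 := by
    rw [← Int.cast_natCast, Padic.norm_intCast_lt_one_iff]
    exact_mod_cast hdvd
  have h3 : (q : ℚ_[ℓ]) * (q.den : ℚ_[ℓ]) = (q.num : ℚ_[ℓ]) := by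
    have := Rat.mul_den_eq_num q
    exact_mod_cast congrArg (fun x : ℚ => (x : ℚ_[ℓ])) this
  have h4 := congrArg norm h3
  rw [norm_mul, h1] at h4
  nlinarith [h ℓ, norm_nonneg (q : ℚ_[ℓ]), norm_nonneg ((q.den : ℕ) : ℚ_[ℓ])]

theorem padic_norm_sub_le {ℓ : ℕ} [Fact ℓ.Prime] {a b : ℚ_[ℓ]} {c : ℝ} (ha : ‖a‖ ≤ c)
    (hb : ‖b‖ ≤ c) : ‖a - b‖ ≤ c := by
  rw [sub_eq_add_neg]
  exact (IsUltrametricDist.norm_add_le_max _ _).trans (max_le ha (by rwa [norm_neg]))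

theorem norm_natCast_eq_one {ℓ n : ℕ} [hℓ : Fact ℓ.Prime] (h : n.Coprime ℓ) :
    ‖(n : ℚ_[ℓ])‖ = 1 :=
  Padic.norm_natCast_eq_one_iff.2 h.symm

/-- An `ℓ`-adic number is congruent modulo `ℤ_ℓ` to an element of `ℤ[1/ℓ]`. -/
theorem exists_rat_norm_sub_le_one (ℓ : ℕ) [hℓ : Fact ℓ.Prime] (t : ℚ_[ℓ]) :
    ∃ s : ℚ, ‖t - s‖ ≤ 1 ∧ ∀ ℓ' : ℕ, [Fact ℓ'.Prime] → ℓ' ≠ ℓ → ‖(s : ℚ_[ℓ'])‖ ≤ 1 := by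
  have h0 : Filter.Tendsto (fun n : ℕ => (ℓ : ℚ_[ℓ]) ^ n * t) Filter.atTop (nhds 0) := by
    simpa using (tendsto_pow_atTop_nhds_zero_of_norm_lt_one (Padic.norm_p_lt_one (p := ℓ))).mul_const t
  obtain ⟨n, hn⟩ := (h0.eventually (Metric.ball_mem_nhds 0 one_pos)).exists
  replace hn : ‖(ℓ : ℚ_[ℓ]) ^ n * t‖ < 1 := by simpa only [dist_zero_right] using hn
  let x : ℤ_[ℓ] := ⟨(ℓ : ℚ_[ℓ]) ^ n * t, hn.le⟩
  have hx := (PadicInt.norm_le_pow_iff_mem_span_pow _ n).2 (PadicInt.appr_spec n x)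
  have hp : (ℓ : ℚ_[ℓ]) ≠ 0 := by exact_mod_cast hℓ.1.ne_zero
  -- After scaling by `ℓ ^ n`, `t` becomes integral; it is truncated modulo `ℓ ^ n` and scaled back,
  -- which leaves an error in `ℤ_ℓ` and a denominator that is a power of `ℓ`.
  refine ⟨(x.appr n : ℚ) / (ℓ : ℚ) ^ n, ?_, ?_⟩
  · have e : t - (((x.appr n : ℚ) / (ℓ : ℚ) ^ n : ℚ) : ℚ_[ℓ]) =
        ((x - (x.appr n : ℤ_[ℓ]) : ℤ_[ℓ]) : ℚ_[ℓ]) / (ℓ : ℚ_[ℓ]) ^ n := by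
      push_cast
      rw [eq_div_iff (pow_ne_zero _ hp), sub_mul, div_mul_cancel₀ _ (pow_ne_zero _ hp), mul_comm]
    rw [e, norm_div, norm_pow, Padic.norm_p, PadicInt.padic_norm_e_of_padicInt, div_le_one]
    · simpa [zpow_neg] using hx
    · have := hℓ.1.pos
      positivity
  · intro ℓ' _ hne
    push_cast
    rw [norm_div, norm_pow,
      norm_natCast_eq_one ((Nat.coprime_primes hℓ.1 (Fact.out : ℓ'.Prime)).2 hne.symm), one_pow,
      div_one]
    exact_mod_cast Padic.norm_int_le_one (x.appr n : ℤ)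

variable {p : ℕ}

theorem norm_rat_sum_le_one {ι : Type*} (s : Finset ι) (q : ι → ℚ) (ℓ : ℕ) [Fact ℓ.Prime]
    (h : ∀ i ∈ s, ‖(q i : ℚ_[ℓ])‖ ≤ 1) : ‖((∑ i ∈ s, q i : ℚ) : ℚ_[ℓ])‖ ≤ 1 := by
  push_cast
  exact IsUltrametricDist.norm_sum_le_of_forall_le_of_nonneg zero_le_one h

/-- `ℚ^(p)` is the sum of `∏_{ℓ ≠ p} ℤ_ℓ` and the ring of `p`-integral rational numbers. -/
theorem exists_rat_approx [Fact p.Prime] (t : AdeleQ p) :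
    ∃ s : ℚ, ‖(s : ℚ_[p])‖ ≤ 1 ∧ ∀ ℓ : PrimesAway p, ‖t ℓ - s‖ ≤ 1 := by
  classical
  choose s hs hs' using fun ℓ : PrimesAway p => exists_rat_norm_sub_le_one (ℓ.1 : ℕ) (t ℓ)
  have hfin : {ℓ : PrimesAway p | ¬ ‖t ℓ‖ ≤ 1}.Finite := Filter.eventually_cofinite.1 t.2
  -- Partial fractions: the polar parts at the finitely many non-integral places are added, each
  -- being integral at every other prime, including `p`.
  refine ⟨∑ ℓ ∈ hfin.toFinset, s ℓ, norm_rat_sum_le_one _ _ _ fun ℓ _ => hs' ℓ p ℓ.2.symm,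
    fun ℓ => ?_⟩
  have hne : ∀ ℓ' : PrimesAway p, ℓ' ≠ ℓ → ‖(s ℓ' : ℚ_[(ℓ.1 : ℕ)])‖ ≤ 1 := fun ℓ' h =>
    hs' ℓ' (ℓ.1 : ℕ) fun e => h (Subtype.ext (Subtype.ext e.symm))
  by_cases hℓ : ℓ ∈ hfin.toFinset
  · rw [← Finset.add_sum_erase _ _ hℓ, Rat.cast_add, ← sub_sub]
    refine padic_norm_sub_le (hs ℓ) ?_
    exact norm_rat_sum_le_one _ _ _ fun ℓ' h => hne ℓ' (Finset.ne_of_mem_erase h)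
  · refine padic_norm_sub_le ?_ ?_
    · simpa using hℓ
    · exact norm_rat_sum_le_one _ _ _ fun ℓ' h => hne ℓ' fun e => hℓ (e ▸ h)

variable (p) in
/-- The diagonal embedding of `ℚ` in `ℚ^(p)`. -/
def ratAdele (q : ℚ) : AdeleQ p :=
  RestrictedProduct.mk (fun _ => (q : ℚ_[_])) <| by
    filter_upwards [finite_primes_dvd p (m := q.den) (by exact_mod_cast q.den_nz)] with ℓ hℓ
    exact Padic.norm_rat_le_one fun h => hℓ (by exact_mod_cast h)

end

/-! ### Haar measure of boxes -/

section

open MeasureTheory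

variable (p : ℕ)

/-- The compact open set `a + c ∏ ℤ_ℓ` in `ℚ^(p)`. -/
def adelicBox (c a : ℚ) : Set (AdeleQ p) :=
  {t | ∀ ℓ : PrimesAway p, ‖t ℓ - (a : ℚ_[(ℓ.1 : ℕ)])‖ ≤ ‖(c : ℚ_[(ℓ.1 : ℕ)])‖}

variable {p}

theorem adelicBox_eq_preimage_add (c a : ℚ) :
    adelicBox p c a = (fun t => t + ratAdele p (-a)) ⁻¹' adelicBox p c 0 := by
  ext t
  refine forall_congr' fun ℓ => ?_
  change _ ↔ ‖t ℓ + ((-a : ℚ) : ℚ_[(ℓ.1 : ℕ)]) - ((0 : ℚ) : ℚ_[(ℓ.1 : ℕ)])‖ ≤ _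
  push_cast
  rw [sub_zero, sub_eq_add_neg]

theorem adelicBox_eq_preimage_mul {c : ℚ} (hc : c ≠ 0) :
    adelicBox p c 0 = (fun t => ratAdele p c⁻¹ * t) ⁻¹' (integralAdeles p : Set (AdeleQ p)) := by
  ext t
  refine forall_congr' fun ℓ => ?_
  change _ ↔ ‖((c⁻¹ : ℚ) : ℚ_[(ℓ.1 : ℕ)]) * t ℓ‖ ≤ 1
  have : 0 < ‖(c : ℚ_[(ℓ.1 : ℕ)])‖ := norm_pos_iff.2 (by exact_mod_cast hc)
  push_cast
  rw [sub_zero, norm_mul, norm_inv, inv_mul_le_iff₀ this, mul_one]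

theorem adelicBox_eq_image {c : ℚ} (hc : c ≠ 0) :
    adelicBox p c 0 = (fun t => ratAdele p c * t) '' (integralAdeles p : Set (AdeleQ p)) := by
  have h : ∀ a : ℚ, a ≠ 0 → ratAdele p a * ratAdele p a⁻¹ = 1 := fun a ha => by
    refine RestrictedProduct.ext _ _ fun ℓ => ?_
    change (a : ℚ_[(ℓ.1 : ℕ)]) * ((a⁻¹ : ℚ) : ℚ_[(ℓ.1 : ℕ)]) = 1
    push_cast
    exact mul_inv_cancel₀ (by exact_mod_cast ha)
  rw [adelicBox_eq_preimage_mul hc]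
  refine (congrFun (Set.image_eq_preimage_of_inverse ?_ ?_) _).symm
  · intro t
    dsimp only
    rw [← mul_assoc, mul_comm (ratAdele p c⁻¹), h c hc, one_mul]
  · intro t
    dsimp only
    rw [← mul_assoc, h c hc, one_mul]

theorem isOpen_adelicBox {c : ℚ} (hc : c ≠ 0) : IsOpen (adelicBox p c 0) := by
  have ho : IsOpen (integralAdeles p : Set (AdeleQ p)) :=
    RestrictedProduct.isOpen_forall_mem (Fact.out (p := ∀ ℓ : PrimesAway p,
      IsOpen (PadicInt.subring (ℓ.1 : ℕ) : Set ℚ_[(ℓ.1 : ℕ)])))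
  rw [adelicBox_eq_preimage_mul hc]
  exact ho.preimage (continuous_const.mul continuous_id)

theorem isCompact_adelicBox {c : ℚ} (hc : c ≠ 0) : IsCompact (adelicBox p c 0) := by
  rw [adelicBox_eq_image hc]
  exact (integralAdeles p).isCompact.image (continuous_const.mul continuous_id)

theorem measurableSet_adelicBox {c : ℚ} (hc : c ≠ 0) (a : ℚ) :
    MeasurableSet (adelicBox p c a) := by
  rw [adelicBox_eq_preimage_add]
  exact ((isOpen_adelicBox hc).preimage (continuous_id.add continuous_const)).measurableSet

theorem addHaar_adelicBox (c a : ℚ) :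
    Measure.addHaarMeasure (integralAdeles p) (adelicBox p c a) =
      Measure.addHaarMeasure (integralAdeles p) (adelicBox p c 0) := by
  rw [adelicBox_eq_preimage_add]
  exact measure_preimage_add_right _ _ _

theorem addHaar_adelicBox_ne_top {c : ℚ} (hc : c ≠ 0) (a : ℚ) :
    Measure.addHaarMeasure (integralAdeles p) (adelicBox p c a) ≠ ⊤ := by
  rw [addHaar_adelicBox]
  exact (isCompact_adelicBox hc).measure_lt_top.ne

theorem addHaar_adelicBox_ne_zero {c : ℚ} (hc : c ≠ 0) :
    Measure.addHaarMeasure (integralAdeles p) (adelicBox p c 0) ≠ 0 :=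
  (isOpen_adelicBox hc).measure_ne_zero _ ⟨0, fun ℓ => by
    change ‖(0 : ℚ_[(ℓ.1 : ℕ)]) - ((0 : ℚ) : ℚ_[(ℓ.1 : ℕ)])‖ ≤ _
    rw [Rat.cast_zero, sub_zero, norm_zero]
    exact norm_nonneg _⟩

/-- If a function on `ℚ^(p)` is a combination of indicators of translates of a box and has
Haar integral `0`, the sum of its coefficients is `0`. -/
theorem sum_eq_zero_of_haarIntegral_eq_zero {g : AdeleQ p → ℤ} {ι : Type*} {s : Finset ι}
    {c : ℚ} (hc : c ≠ 0) (a : ι → ℚ) (b : ι → ℤ)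
    (hg : ∀ t, (g t : ℝ) = ∑ i ∈ s, (adelicBox p c (a i)).indicator (fun _ => (b i : ℝ)) t)
    (h : haarIntegral p g = 0) : ∑ i ∈ s, b i = 0 := by
  unfold haarIntegral at h
  simp only [hg] at h
  rw [integral_finsetSum _ fun i _ => (integrable_indicator_iff (measurableSet_adelicBox hc _)).2
    (integrableOn_const (addHaar_adelicBox_ne_top hc _))] at h
  simp only [integral_indicator_const _ (measurableSet_adelicBox hc _), measureReal_def,
    addHaar_adelicBox c (a _), smul_eq_mul, ← Finset.mul_sum] at h
  -- The integral is now the common measure of the boxes, finite and non-zero, times the sum of the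
  -- coefficients.
  rcases mul_eq_zero.1 h with h | h
  · rw [ENNReal.toReal_eq_zero_iff] at h
    exact (h.elim (addHaar_adelicBox_ne_zero hc) (addHaar_adelicBox_ne_top hc 0)).elim
  · exact_mod_cast h

end

/-! ### The vanishing hypothesis on the lattice -/

section

theorem toLoc_smul (ℓ : ℕ) [Fact ℓ.Prime] {V : Type*} [AddCommGroup V] [Module ℚ V] (q : ℚ)
    (v : V) : toLoc ℓ (q • v) = (q : ℚ_[ℓ]) • toLoc ℓ v := by
  rw [toLoc, toLoc, TensorProduct.tmul_smul, TensorProduct.smul_tmul', TensorProduct.smul_tmul',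
    Rat.smul_def, smul_eq_mul]

theorem smul_toLoc_mem (ℓ : ℕ) [Fact ℓ.Prime] {V : Type*} [AddCommGroup V] [Module ℚ V]
    {L : Submodule ℤ V} {z : ℚ_[ℓ]} (hz : ‖z‖ ≤ 1) (u : L) : z • toLoc ℓ (u : V) ∈ Lloc ℓ L :=
  (Lloc ℓ L).smul_mem (⟨z, hz⟩ : ℤ_[ℓ]) (toLoc_mem ℓ L u.2)

variable {p : ℕ}

theorem adelicBox_subset_of_dvd {c : ℚ} {m n : ℕ} (h : m ∣ n) (a : ℚ) :
    adelicBox p (c * n) a ⊆ adelicBox p (c * m) a := by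
  intro t ht ℓ
  obtain ⟨k, rfl⟩ := h
  refine (ht ℓ).trans ?_
  push_cast
  rw [← mul_assoc, norm_mul _ (k : ℚ_[(ℓ.1 : ℕ)])]
  refine mul_le_of_le_one_right (norm_nonneg _) ?_
  exact_mod_cast Padic.norm_int_le_one (k : ℤ)

theorem mem_adelicBox_of_sub_eq {c : ℚ} {m : ℕ} {k j e : ℤ} (h : k - j = m * e) {t : AdeleQ p}
    (ht : t ∈ adelicBox p (c * m) (k * c)) : t ∈ adelicBox p (c * m) (j * c) := by
  intro ℓ
  have h' : (k : ℚ_[(ℓ.1 : ℕ)]) - j = m * e := by exact_mod_cast congrArg (Int.cast) h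
  have e1 : t ℓ - ((j * c : ℚ) : ℚ_[(ℓ.1 : ℕ)]) = (t ℓ - ((k * c : ℚ) : ℚ_[(ℓ.1 : ℕ)])) -
      -(((c * m : ℚ) : ℚ_[(ℓ.1 : ℕ)]) * e) := by
    push_cast
    linear_combination (c : ℚ_[(ℓ.1 : ℕ)]) * h'
  rw [e1]
  refine padic_norm_sub_le (ht ℓ) ?_
  rw [norm_neg, norm_mul]
  exact mul_le_of_le_one_right (norm_nonneg _) (Padic.norm_int_le_one e)

variable {V : Type*} [AddCommGroup V] [Module ℚ V] {L : Submodule ℤ V}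

variable (p) in
/-- The diagonal embedding of `L` in `∏ L_ℓ`. -/
def diagLattice (x : L) (ℓ : PrimesAway p) : Lloc (ℓ.1 : ℕ) L := latticeToLoc (ℓ.1 : ℕ) L x

variable [L.IsLattice ℚ]

/-- Writing `t = jc + cmz` with `z` integral away from `p`, and using `cv = u`, one gets `x + tv =
(x + ju) + m(zu)`; `b` is `zu`. -/
theorem line_eq_shift_of_mem_adelicBox {v : V} {u : L} {c : ℚ} (hc : c ≠ 0)
    (huv : (u : V) = c • v) {m : ℕ} (hm0 : m ≠ 0) (x : L) (j : ℕ) {t : AdeleQ p}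
    (ht : t ∈ adelicBox p (c * m) (j * c)) :
    ∃ b, line p L v x t =
      shift p (diag p L 0) (diagLattice p (x + j • u) + m • b) := by
  have hz : ∀ ℓ : PrimesAway p,
      ‖(t ℓ - ((j * c : ℚ) : ℚ_[(ℓ.1 : ℕ)])) / ((c * m : ℚ) : ℚ_[(ℓ.1 : ℕ)])‖ ≤ 1 := fun ℓ => by
    rw [norm_div]
    exact div_le_one_of_le₀ (ht ℓ) (norm_nonneg _)
  refine ⟨fun ℓ => ⟨_, smul_toLoc_mem (ℓ.1 : ℕ) (hz ℓ) u⟩, ?_⟩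
  refine RestrictedProduct.ext _ _ fun ℓ => ?_
  change toLoc (ℓ.1 : ℕ) (x : V) + t ℓ • toLoc (ℓ.1 : ℕ) v = toLoc (ℓ.1 : ℕ) (0 : V) +
    (toLoc (ℓ.1 : ℕ) ((x : V) + j • (u : V)) +
      m • (((t ℓ - ((j * c : ℚ) : ℚ_[(ℓ.1 : ℕ)])) / ((c * m : ℚ) : ℚ_[(ℓ.1 : ℕ)])) •
        toLoc (ℓ.1 : ℕ) (u : V)))
  have h0 : toLoc (ℓ.1 : ℕ) (0 : V) = 0 := TensorProduct.tmul_zero _ _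
  have hc' : (c : ℚ_[(ℓ.1 : ℕ)]) ≠ 0 := by exact_mod_cast hc
  have hm' : (m : ℚ_[(ℓ.1 : ℕ)]) ≠ 0 := by exact_mod_cast hm0
  rw [h0, zero_add, toLoc_add, ← Nat.cast_smul_eq_nsmul ℚ, toLoc_smul, huv, toLoc_smul,
    ← Nat.cast_smul_eq_nsmul ℚ_[(ℓ.1 : ℕ)], add_assoc, smul_smul, smul_smul, smul_smul,
    ← add_smul]
  congr 2
  push_cast
  field_simp
  ring

/-- The same computation with a rational `s` in place of `j`: it moves a point of the adelic line to
a rational point by a multiple of `m`, so that information on `V` can be used. -/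
theorem shift_line_eq_diag {v : V} {u : L} {c : ℚ} (hc : c ≠ 0) (huv : (u : V) = c • v)
    {m : ℕ} (hm0 : m ≠ 0) (x : L) {t : AdeleQ p} {s : ℚ}
    (hs : t ∈ adelicBox p (c * m) (s * c)) :
    ∃ b, shift p (line p L v x t) (m • b) = diag p L ((x : V) + s • (u : V)) := by
  have hz : ∀ ℓ : PrimesAway p,
      ‖-((t ℓ - ((s * c : ℚ) : ℚ_[(ℓ.1 : ℕ)])) / ((c * m : ℚ) : ℚ_[(ℓ.1 : ℕ)]))‖ ≤ 1 := fun ℓ => by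
    rw [norm_neg, norm_div]
    exact div_le_one_of_le₀ (hs ℓ) (norm_nonneg _)
  refine ⟨fun ℓ => ⟨_, smul_toLoc_mem (ℓ.1 : ℕ) (hz ℓ) u⟩, ?_⟩
  refine RestrictedProduct.ext _ _ fun ℓ => ?_
  change toLoc (ℓ.1 : ℕ) (x : V) + t ℓ • toLoc (ℓ.1 : ℕ) v +
      m • ((-((t ℓ - ((s * c : ℚ) : ℚ_[(ℓ.1 : ℕ)])) / ((c * m : ℚ) : ℚ_[(ℓ.1 : ℕ)]))) •
        toLoc (ℓ.1 : ℕ) (u : V)) = toLoc (ℓ.1 : ℕ) ((x : V) + s • (u : V))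
  have hc' : (c : ℚ_[(ℓ.1 : ℕ)]) ≠ 0 := by exact_mod_cast hc
  have hm' : (m : ℚ_[(ℓ.1 : ℕ)]) ≠ 0 := by exact_mod_cast hm0
  rw [toLoc_add, toLoc_smul, huv, toLoc_smul,
    ← Nat.cast_smul_eq_nsmul ℚ_[(ℓ.1 : ℕ)], add_assoc, smul_smul, smul_smul, smul_smul,
    ← add_smul]
  congr 2
  push_cast
  field_simp
  ring

variable [Fact p.Prime]

theorem TestFunction.tensorLp_of_mem (f' : TestFunction p L) {v : V}
    (hv : toLoc p v ∈ Lloc p L) : f'.tensorLp v = f'.toFun (diag p L v) := by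
  rw [TestFunction.tensorLp, if_pos hv]

/-- Every adele is congruent to a `p`-integral rational number modulo `c m ∏ ℤ_ℓ`. -/
theorem exists_mem_adelicBox {c : ℚ} (hc : c ≠ 0) {m : ℕ} (hm0 : m ≠ 0) (t : AdeleQ p) :
    ∃ s : ℚ, ‖(s : ℚ_[p])‖ ≤ 1 ∧ t ∈ adelicBox p (c * m) (s * c) := by
  obtain ⟨s, hs, hs'⟩ := exists_rat_approx (ratAdele p (c * m)⁻¹ * t)
  refine ⟨m * s, ?_, fun ℓ => ?_⟩
  · push_cast
    rw [norm_mul]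
    refine mul_le_one₀ ?_ (norm_nonneg _) hs
    exact_mod_cast Padic.norm_int_le_one (m : ℤ)
  · have hc' : (c : ℚ_[(ℓ.1 : ℕ)]) ≠ 0 := by exact_mod_cast hc
    have hm' : (m : ℚ_[(ℓ.1 : ℕ)]) ≠ 0 := by exact_mod_cast hm0
    have h : ‖(((c * m)⁻¹ : ℚ) : ℚ_[(ℓ.1 : ℕ)]) * t ℓ - s‖ ≤ 1 := hs' ℓ
    have e : t ℓ - ((m * s * c : ℚ) : ℚ_[(ℓ.1 : ℕ)]) = ((c * m : ℚ) : ℚ_[(ℓ.1 : ℕ)]) *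
        ((((c * m)⁻¹ : ℚ) : ℚ_[(ℓ.1 : ℕ)]) * t ℓ - s) := by
      push_cast
      field_simp
    rw [e, norm_mul]
    exact mul_le_of_le_one_right (norm_nonneg _) h

/-- The number `(i - j) / m` is integral at each `ℓ ≠ p` by the two memberships, and at `p` because
`m` is prime to `p`. It is an integer of absolute value less than 1. -/
theorem eq_of_mem_adelicBox {c : ℚ} (hc : c ≠ 0) {m : ℕ} (hm : m.Coprime p) {i j : ℕ}
    (hi : i < m) (hj : j < m) {t : AdeleQ p} (ht : t ∈ adelicBox p (c * m) (i * c))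
    (ht' : t ∈ adelicBox p (c * m) (j * c)) : i = j := by
  have hm0 : m ≠ 0 := by omega
  obtain ⟨k, hk⟩ := exists_int_eq_of_norm_le_one (((i : ℚ) - j) / m) (by
    intro ℓ hℓ
    have hm' : (m : ℚ_[ℓ]) ≠ 0 := by exact_mod_cast hm0
    by_cases hℓp : ℓ = p
    · subst hℓp
      push_cast
      rw [norm_div, norm_natCast_eq_one hm, div_one]
      exact_mod_cast Padic.norm_int_le_one ((i : ℤ) - j)
    · let ℓ' : PrimesAway p := ⟨⟨ℓ, hℓ.1⟩, hℓp⟩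
      have h1 : ‖t ℓ' - ((i * c : ℚ) : ℚ_[ℓ])‖ ≤ ‖((c * m : ℚ) : ℚ_[ℓ])‖ := ht ℓ'
      have h2 : ‖t ℓ' - ((j * c : ℚ) : ℚ_[ℓ])‖ ≤ ‖((c * m : ℚ) : ℚ_[ℓ])‖ := ht' ℓ'
      have hc' : (c : ℚ_[ℓ]) ≠ 0 := by exact_mod_cast hc
      have e : ((((i : ℚ) - j) / m : ℚ) : ℚ_[ℓ]) = ((t ℓ' - ((j * c : ℚ) : ℚ_[ℓ])) -
          (t ℓ' - ((i * c : ℚ) : ℚ_[ℓ]))) / ((c * m : ℚ) : ℚ_[ℓ]) := by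
        push_cast
        field_simp
        ring
      rw [e, norm_div]
      exact div_le_one_of_le₀ (padic_norm_sub_le h2 h1) (norm_nonneg _))
  have hk' : (i : ℤ) - j = m * k := by
    have hm' : (m : ℚ) ≠ 0 := by exact_mod_cast hm0
    rw [div_eq_iff hm'] at hk
    rw [mul_comm]
    exact_mod_cast hk
  have : k = 0 := by
    have h1 : (m : ℤ) * k < m * 1 := by omega
    have h2 : (m : ℤ) * (-1) < m * k := by omega
    have := lt_of_mul_lt_mul_left h1 (by positivity)
    have := lt_of_mul_lt_mul_left h2 (by positivity)
    omega
  subst this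
  omega

/-- If `u` generates `L ∩ ℚ v`, the vanishing hypothesis for `v` says that the sums of
`f' ⊗ [L_p]` along a period in the direction `u` vanish. -/
theorem TestFunction.sum_tensorLp_eq_zero (f' : TestFunction p L) (hf' : f'.SupportedOn) {v : V}
    (hv : f'.VanishingHypothesis v) {u : L} {c : ℚ} (hc : c ≠ 0) (huv : (u : V) = c • v)
    (hprim : ∀ s : ℚ, s • (u : V) ∈ L → ∃ k : ℤ, s = k) {m : ℕ} (hm0 : m ≠ 0)
    (hm : m.Coprime p) (hper : ∀ a b, f'.toFun (shift p (diag p L 0) (a + m • b)) =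
      f'.toFun (shift p (diag p L 0) a)) (x : L) :
    ∑ j ∈ Finset.range m, f'.tensorLp ((x : V) + j • (u : V)) = 0 := by
  have hcm : c * m ≠ 0 := mul_ne_zero hc (by exact_mod_cast hm0)
  have hval : ∀ (j : ℕ) (t : AdeleQ p), t ∈ adelicBox p (c * m) (j * c) →
      f'.restrict v x t = f'.tensorLp ((x : V) + j • (u : V)) := by
    intro j t ht
    obtain ⟨b, hb⟩ := line_eq_shift_of_mem_adelicBox hc huv hm0 x j ht
    rw [TestFunction.restrict, hb, hper]
    refine Eq.trans ?_ (f'.tensorLp_of_mem (toLoc_mem p L (x + j • u).2)).symm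
    congr 1
    refine RestrictedProduct.ext _ _ fun ℓ => ?_
    change toLoc (ℓ.1 : ℕ) (0 : V) + toLoc (ℓ.1 : ℕ) ((x : V) + j • (u : V)) = _
    rw [← toLoc_add, zero_add]
    rfl
  have hsupp : ∀ t : AdeleQ p, f'.restrict v x t ≠ 0 →
      ∃ j < m, t ∈ adelicBox p (c * m) (j * c) := by
    intro t ht
    -- This point need not lie in `∏ L_ℓ`, where `m` is a period, so a second period `n` is taken on
    -- its own coset. Approximating `t` modulo `c m n` serves both `n`, here, and `m`, at the end.
    obtain ⟨n, hn0, -, hn⟩ := f'.exists_period (line p L v x t)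
    obtain ⟨s, hs, hst⟩ := exists_mem_adelicBox hc (mul_ne_zero hm0 hn0) t
    obtain ⟨b, hb⟩ := shift_line_eq_diag hc huv hn0 x
      (adelicBox_subset_of_dvd (Dvd.intro_left m rfl) _ hst)
    have hmem : toLoc p ((x : V) + s • (u : V)) ∈ Lloc p L := by
      rw [toLoc_add, toLoc_smul]
      exact Submodule.add_mem _ (toLoc_mem p L x.2)
        (smul_toLoc_mem p hs u)
    have h1 : f'.tensorLp ((x : V) + s • (u : V)) ≠ 0 := by
      rw [f'.tensorLp_of_mem hmem, ← hb]
      have := hn 0 b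
      rw [zero_add] at this
      rw [this]
      convert! ht using 2
    have h2 : (x : V) + s • (u : V) ∈ L := by
      by_contra h
      exact h1 (hf' _ h)
    -- The non-zero value at the rational point `x + su` puts it in `L`; primitivity of `u` makes
    -- `s` an integer, to be reduced modulo `m`.
    obtain ⟨k, rfl⟩ := hprim s ((Submodule.add_mem_iff_right _ x.2).1 h2)
    have hm1 : (m : ℤ) ≠ 0 := by exact_mod_cast hm0
    have hpos := Int.emod_nonneg k hm1
    have hlt := Int.emod_lt_of_pos k (by omega : (0 : ℤ) < m)
    refine ⟨(k % m).toNat, by omega, ?_⟩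
    have h3 := mem_adelicBox_of_sub_eq (k := k) (j := k % m) (e := k / m)
      (by linarith [Int.emod_add_mul_ediv k m])
      (adelicBox_subset_of_dvd (Dvd.intro n rfl) _ hst)
    rwa [← Int.toNat_of_nonneg hpos, Int.cast_natCast] at h3
  refine sum_eq_zero_of_haarIntegral_eq_zero hcm (fun j : ℕ => (j * c : ℚ)) _ (fun t => ?_) (hv x)
  by_cases ht : f'.restrict v x t = 0
  · rw [ht, Int.cast_zero]
    refine (Finset.sum_eq_zero fun j _ => ?_).symm
    by_cases hj : t ∈ adelicBox p (c * m) (j * c)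
    · rw [Set.indicator_of_mem hj, ← hval j t hj, ht, Int.cast_zero]
    · rw [Set.indicator_of_notMem hj]
  · obtain ⟨j, hjm, hj⟩ := hsupp t ht
    rw [Finset.sum_eq_single_of_mem j (Finset.mem_range.2 hjm), Set.indicator_of_mem hj,
      hval j t hj]
    intro i hi hij
    exact Set.indicator_of_notMem
      (fun h => hij (eq_of_mem_adelicBox hc hm (Finset.mem_range.1 hi) hjm h hj)) _

end

/-! ### Coordinates on rational cones -/

section

variable {V : Type*} [AddCommGroup V] [Module ℚ V]

/-- Rational points of the open cone generated by a linearly independent family, in terms of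
coordinates. -/
theorem exists_coord_openCone {ι : Type*} [DecidableEq ι] (v : ι → V) (S : Finset ι)
    (hli : LinearIndependent ℚ (fun i : S => v i)) :
    ∃ c : ι → V →ₗ[ℚ] ℚ, (∀ i ∈ S, ∀ j ∈ S, c i (v j) = if i = j then 1 else 0) ∧
      ∀ x, (1 : ℝ) ⊗ₜ[ℚ] x ∈ openCone v S ↔
        (∀ i ∈ S, 0 < c i x) ∧ x = ∑ i ∈ S, c i x • v i := by
  obtain ⟨g, hg⟩ := LinearMap.exists_leftInverse_of_injective
    (Finsupp.linearCombination ℚ (fun i : S => v i)) (LinearMap.ker_eq_bot.2 hli)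
  have hgv : ∀ i : S, g (v i) = Finsupp.single i 1 := fun i => by
    have := LinearMap.congr_fun hg (Finsupp.single i 1)
    simpa using this
  let c : ι → V →ₗ[ℚ] ℚ := fun i =>
    if h : i ∈ S then (Finsupp.lapply (⟨i, h⟩ : S)).comp g else 0
  have hcv : ∀ i ∈ S, ∀ j ∈ S, c i (v j) = if i = j then 1 else 0 := by
    intro i hi j hj
    simp only [c, hi, dite_true, LinearMap.comp_apply, hgv ⟨j, hj⟩, Finsupp.lapply_apply,
      Finsupp.single_apply, Subtype.mk.injEq, eq_comm]
  refine ⟨c, hcv, fun x => ⟨?_, ?_⟩⟩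
  · rintro ⟨a, ha, hx⟩
    -- The real extension of `c i` reads off the coefficient `a i`, which is therefore rational.
    have hca : ∀ i ∈ S, (c i x : ℝ) = a i := by
      intro i hi
      have := congrArg (fun y => TensorProduct.rid ℚ ℝ ((c i).lTensor ℝ y)) hx
      simp only [map_sum, LinearMap.lTensor_tmul, TensorProduct.rid_tmul] at this
      rw [Finset.sum_eq_single_of_mem i hi fun j hj hji => by
        rw [hcv i hi j hj, if_neg hji.symm, zero_smul], hcv i hi i hi, if_pos rfl, one_smul] at this
      rw [← this, Rat.smul_def, mul_one]
    refine ⟨fun i hi => ?_, ?_⟩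
    · have := ha i hi
      rw [← hca i hi] at this
      exact_mod_cast this
    · apply Module.FaithfullyFlat.tensorProduct_mk_injective (A := ℚ) (B := ℝ) V
      change (1 : ℝ) ⊗ₜ[ℚ] x = (1 : ℝ) ⊗ₜ[ℚ] (∑ i ∈ S, c i x • v i)
      rw [hx, TensorProduct.tmul_sum]
      refine Finset.sum_congr rfl fun i hi => ?_
      rw [TensorProduct.tmul_smul, TensorProduct.smul_tmul', Rat.smul_def, mul_one, hca i hi]
  · rintro ⟨h1, h2⟩
    refine ⟨fun i => c i x, fun i hi => Rat.cast_pos.2 (h1 i hi), ?_⟩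
    conv_lhs => rw [h2]
    rw [TensorProduct.tmul_sum]
    refine Finset.sum_congr rfl fun i _ => ?_
    rw [TensorProduct.tmul_smul, TensorProduct.smul_tmul', Rat.smul_def, mul_one]

variable (L : Submodule ℤ V) [hL : L.IsLattice ℚ]

/-- A linear form takes values with bounded denominators on a lattice. -/
theorem exists_common_den (c : V →ₗ[ℚ] ℚ) :
    ∃ d : ℕ, d ≠ 0 ∧ ∀ x ∈ L, ∃ k : ℤ, (d : ℚ) * c x = k := by
  obtain ⟨s, hs⟩ := hL.fg
  refine ⟨∏ x ∈ s, (c x).den, Finset.prod_ne_zero_iff.2 fun x _ => (c x).den_nz, fun x hx => ?_⟩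
  rw [← hs] at hx
  induction hx using Submodule.span_induction with
  | mem x hx =>
    obtain ⟨e, he⟩ := Finset.dvd_prod_of_mem (fun x => (c x).den) hx
    refine ⟨e * (c x).num, ?_⟩
    rw [he]
    push_cast
    rw [mul_right_comm, Rat.den_mul_eq_num, mul_comm]
  | zero => exact ⟨0, by simp⟩
  | add x y _ _ hx hy =>
    obtain ⟨k, hk⟩ := hx
    obtain ⟨k', hk'⟩ := hy
    exact ⟨k + k', by rw [map_add, mul_add, hk, hk']; push_cast; rfl⟩
  | smul a x _ hx =>
    obtain ⟨k, hk⟩ := hx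
    refine ⟨a * k, ?_⟩
    rw [← Int.cast_smul_eq_zsmul ℚ, map_smul, smul_eq_mul, mul_left_comm, hk]
    push_cast
    rfl

/-- The intersection of a lattice with a line is generated by one vector. -/
theorem exists_primitive {v : V} (hv : v ≠ 0) : ∃ (u : L) (q : ℚ), 0 < q ∧ (u : V) = q • v ∧
    ∀ s : ℚ, s • (u : V) ∈ L → ∃ k : ℤ, s = k := by
  classical
  obtain ⟨c, hc, -⟩ := exists_coord_openCone (fun _ : Unit => v) {()}
    (linearIndependent_unique_iff.2 hv)
  have hcv : c () v = 1 := by simpa using hc () (by simp) () (by simp)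
  obtain ⟨d, hd0, hd⟩ := exists_common_den L (c ())
  have hdq : (d : ℚ) ≠ 0 := by exact_mod_cast hd0
  -- As `c () v = 1`, the denominator `d` confines `L ∩ ℚ v` to multiples of `v / d`; the least
  -- positive `n` with `(n / d) v ∈ L` gives the generator.
  have hex : ∃ n : ℕ, 0 < n ∧ ((n : ℚ) / d) • v ∈ L := by
    obtain ⟨m, hm0, hm⟩ := exists_smul_mem L v
    refine ⟨m.natAbs * d, Nat.mul_pos (Int.natAbs_pos.2 hm0) (Nat.pos_of_ne_zero hd0), ?_⟩
    push_cast
    rw [mul_div_assoc, div_self hdq, mul_one]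
    rcases Int.natAbs_eq m with h | h
    · rw [Nat.cast_smul_eq_nsmul, ← natCast_zsmul, ← h]
      exact hm
    · rw [Nat.cast_smul_eq_nsmul, ← natCast_zsmul, ← neg_neg (m.natAbs : ℤ), ← h, neg_smul]
      exact L.neg_mem hm
  obtain ⟨hn0, hn⟩ := Nat.find_spec hex
  have hmin := fun k (hk : k < Nat.find hex) => Nat.find_min hex hk
  set n := Nat.find hex
  have hnq : (n : ℚ) ≠ 0 := by exact_mod_cast hn0.ne'
  refine ⟨⟨_, hn⟩, (n : ℚ) / d, by positivity, rfl, fun s hs => ?_⟩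
  change s • ((n : ℚ) / d) • v ∈ L at hs
  obtain ⟨k, hk⟩ := hd _ hs
  rw [map_smul, map_smul, hcv, smul_eq_mul, smul_eq_mul, mul_one] at hk
  have hsk : s * n = k := by
    rw [← hk]
    field_simp
  have hpos := Int.emod_nonneg k (by omega : (n : ℤ) ≠ 0)
  have hlt := Int.emod_lt_of_pos k (by omega : (0 : ℤ) < n)
  have hkn : (k : ℚ) = ((k % n).toNat : ℚ) + n * ((k / n : ℤ) : ℚ) := by
    have h1 : (((k % n).toNat : ℤ) : ℚ) = ((k % n : ℤ) : ℚ) := by rw [Int.toNat_of_nonneg hpos]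
    rw [← Int.cast_natCast (k % n).toNat, h1]
    exact_mod_cast (Int.emod_add_mul_ediv k n).symm
  -- Division with remainder: a non-zero remainder would contradict the minimality of `n`.
  have hr : (((k % n).toNat : ℚ) / d) • v ∈ L := by
    have e : (((k % n).toNat : ℚ) / d) • v =
        s • ((n : ℚ) / d) • v - (k / n : ℤ) • ((n : ℚ) / d) • v := by
      rw [← Int.cast_smul_eq_zsmul ℚ, smul_smul, smul_smul, ← sub_smul]
      congr 1
      rw [← mul_div_assoc, hsk, hkn]
      field_simp
      ring
    rw [e]
    exact L.sub_mem hs (L.smul_mem _ hn)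
  have h0 : (k % n).toNat = 0 := by
    by_contra h
    exact hmin _ (by omega) ⟨Nat.pos_of_ne_zero h, hr⟩
  refine ⟨k / n, ?_⟩
  rw [h0, Nat.cast_zero, zero_add, ← hsk, mul_comm] at hkn
  exact mul_left_cancel₀ hnq hkn

/-- A lattice has finitely many points with bounded coordinates. -/
theorem finite_of_coord_mem_Ioc {ι : Type*} (v : ι → V) (S : Finset ι) (c : ι → V →ₗ[ℚ] ℚ)
    (B : ι → ℚ) : {x : L | (∀ i ∈ S, 0 < c i x ∧ c i x ≤ B i) ∧
      (x : V) = ∑ i ∈ S, c i x • v i}.Finite := by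
  choose d hd0 hd using fun i => exists_common_den L (c i)
  -- On `L` the numbers `d i * c i x` are already integers, so the floor loses nothing and the point
  -- is determined by its image.
  refine Set.Finite.of_finite_image (f := fun (x : L) (i : S) => ⌊(d i : ℚ) * c i x⌋) ?_ ?_
  · refine (Set.Finite.pi' fun i : S => Set.finite_Icc (0 : ℤ) ⌊(d i : ℚ) * B i⌋).subset ?_
    rintro _ ⟨x, ⟨hx, -⟩, rfl⟩ i
    obtain ⟨h1, h2⟩ := hx i i.2
    refine ⟨Int.floor_nonneg.2 (by positivity), Int.floor_le_floor ?_⟩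
    gcongr
  · rintro x ⟨-, hx⟩ y ⟨-, hy⟩ hxy
    apply Subtype.ext
    rw [hx, hy]
    refine Finset.sum_congr rfl fun i hi => ?_
    have h := congrFun hxy ⟨i, hi⟩
    obtain ⟨k, hk⟩ := hd i x x.2
    obtain ⟨k', hk'⟩ := hd i y y.2
    simp only [hk, hk', Int.floor_intCast] at h
    have hdi : (d i : ℚ) ≠ 0 := by exact_mod_cast hd0 i
    rw [mul_left_cancel₀ hdi (hk.trans ((congrArg _ h).trans hk'.symm))]

end

/-! ### Generating functions of open cones -/

section

/-- The coefficient at `x` is a combination of values `F(x - ∑ j_i u_i)`, and these points stay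
outside `A` because `A` is stable under adding each `u_i`. It is applied both to the cone and to
half-spaces. -/
theorem mulSeries_prod_qGeomSum_eq_zero {M : Type*} [AddCommGroup M] {ι : Type*} (T : Finset ι)
    (u : ι → M) (m : ℕ) {A : Set M} (hA : ∀ i ∈ T, ∀ x, x - u i ∈ A → x ∈ A) {F : M → ℚ}
    (hF : ∀ x ∉ A, F x = 0) : ∀ x ∉ A, mulSeries (∏ i ∈ T, qGeomSum (u i) m) F x = 0 := by
  classical
  induction T using Finset.induction_on with
  | empty => simpa [mulSeries_one] using hF
  | insert a T ha ih =>
    intro x hx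
    rw [Finset.prod_insert ha, mulSeries_mul, mulSeries_qGeomSum]
    refine Finset.sum_eq_zero fun j hj =>
      ih (fun i hi => hA i (Finset.mem_insert_of_mem hi)) _ ?_
    clear hj
    induction j with
    | zero => simpa using hx
    | succ j ihj =>
      intro h
      rw [add_smul, one_smul, ← sub_sub] at h
      exact ihj (hA a (Finset.mem_insert_self _ _) _ h)

variable {p : ℕ} [Fact p.Prime] {V : Type*} [AddCommGroup V] [Module ℚ V]
  {L : Submodule ℤ V} [L.IsLattice ℚ]

theorem genCoeff_of_mem {f' : TestFunction p L} {C : Set (ℝ ⊗[ℚ] V)} {x : L}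
    (h : (1 : ℝ) ⊗ₜ[ℚ] (x : V) ∈ C) : genCoeff f' C x = f'.tensorLp (x : V) :=
  if_pos h

theorem genCoeff_of_notMem {f' : TestFunction p L} {C : Set (ℝ ⊗[ℚ] V)} {x : L}
    (h : (1 : ℝ) ⊗ₜ[ℚ] (x : V) ∉ C) : genCoeff f' C x = 0 :=
  if_neg h

theorem isMeasureSeries_openCone (f' : TestFunction p L) {ι : Type*} {v : ι → V} {S : Finset ι}
    (hli : LinearIndependent ℚ (fun i : S => v i)) {u : ι → L} {q : ι → ℚ} (hq : ∀ i, 0 < q i)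
    (hu : ∀ i, (u i : V) = q i • v i) {m : ℕ} (hm0 : m ≠ 0) (hm : m.Coprime p)
    (hsum : ∀ i (x : L), ∑ j ∈ Finset.range m, f'.tensorLp ((x : V) + j • (u i : V)) = 0) :
    IsMeasureSeries p (genCoeff f' (openCone v S)) := by
  classical
  obtain ⟨c, hcv, hcone⟩ := exists_coord_openCone v S hli
  have hcu : ∀ i ∈ S, ∀ j ∈ S, c i (u j) = if i = j then q i else 0 := by
    intro i hi j hj
    rw [hu, map_smul, hcv i hi j hj]
    split_ifs with h
    · rw [h, smul_eq_mul, mul_one]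
    · rw [smul_zero]
  have hu0 : ∀ i ∈ S, u i ≠ 0 := by
    intro i hi h
    have := hcu i hi i hi
    rw [h, if_pos rfl, ZeroMemClass.coe_zero, map_zero] at this
    exact (hq i).ne this
  have hshift : ∀ i ∈ S, ∀ (x : L) (a : ℚ), (x : V) + a • (u i : V) =
      ∑ k ∈ S, c k ((x : V) + a • (u i : V)) • v k ↔ (x : V) = ∑ k ∈ S, c k (x : V) • v k := by
    intro i hi x a
    have : ∑ k ∈ S, c k ((x : V) + a • (u i : V)) • v k =
        ∑ k ∈ S, c k (x : V) • v k + a • (u i : V) := by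
      simp only [map_add, map_smul, add_smul, Finset.sum_add_distrib]
      congr 1
      rw [Finset.sum_eq_single_of_mem i hi fun j hj hji => by
        rw [hcu j hj i hi, if_neg hji, smul_zero, zero_smul], hcu i hi i hi, if_pos rfl, hu i,
        smul_eq_mul, mul_smul]
    rw [this, add_left_inj]
  -- It remains to confine the support of the product to the points of the cone with `c i x ≤ m * q
  -- i` for all `i`. The factor at `i` takes care of the `i`-th bound, and the other factors do not
  -- change the `i`-th coordinate.
  refine IsMeasureSeries.of_mulSeries_prod S hu0 hm hm0 (isMeasureSeries_of_finite_support
    ((finite_of_coord_mem_Ioc L v S c fun i => m * q i).subset fun x hx => ?_))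
  rw [Function.mem_support] at hx
  have h1 : (1 : ℝ) ⊗ₜ[ℚ] (x : V) ∈ openCone v S := by
    by_contra h
    refine hx (mulSeries_prod_qGeomSum_eq_zero S u m
      (A := {y : L | (1 : ℝ) ⊗ₜ[ℚ] (y : V) ∈ openCone v S}) (fun i hi y hy => ?_)
      (fun y hy => genCoeff_of_notMem hy) x h)
    have hy' := (hcone _).1 hy
    rw [Submodule.coe_sub, sub_eq_add_neg, ← neg_one_smul ℚ, hshift i hi] at hy'
    refine (hcone _).2 ⟨fun k hk => ?_, hy'.2⟩
    have := hy'.1 k hk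
    rw [map_add, map_smul, hcu k hk i hi, smul_eq_mul] at this
    split_ifs at this <;> nlinarith [hq k]
  obtain ⟨h2, h3⟩ := (hcone _).1 h1
  refine ⟨fun i hi => ⟨h2 i hi, not_lt.1 fun hlt => hx ?_⟩, h3⟩
  rw [← Finset.mul_prod_erase S _ hi, mul_comm, mulSeries_mul]
  refine mulSeries_prod_qGeomSum_eq_zero (S.erase i) u m
    (A := {y : L | c i (y : V) ≤ m * q i}) (fun k hk y hy => ?_) (fun y hy => ?_) x
    (not_le.2 hlt)
  · have : c i ((y - u k : L) : V) ≤ m * q i := hy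
    rw [Submodule.coe_sub, map_sub, hcu i hi k (Finset.mem_of_mem_erase hk),
      if_neg (Finset.ne_of_mem_erase hk).symm, sub_zero] at this
    exact this
  -- Beyond this bound subtracting `j • u i` with `j < m` never crosses the wall `c i = 0`, so the
  -- `m` points lie all inside or all outside the cone.
  · have hy' : m * q i < c i (y : V) := not_le.1 hy
    have hmem : ∀ j ∈ Finset.range m, ((1 : ℝ) ⊗ₜ[ℚ] ((y - j • u i : L) : V) ∈ openCone v S ↔
        (1 : ℝ) ⊗ₜ[ℚ] (y : V) ∈ openCone v S) := by
      intro j hj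
      have e : ((y - j • u i : L) : V) = (y : V) + (-(j : ℚ)) • (u i : V) := by
        rw [neg_smul, ← sub_eq_add_neg, Nat.cast_smul_eq_nsmul]
        rfl
      rw [hcone, hcone, e, hshift i hi]
      refine and_congr_left fun _ => forall₂_congr fun k hk => ?_
      rw [map_add, map_smul, hcu k hk i hi]
      split_ifs with hki
      · subst hki
        have hjm : (j : ℚ) ≤ m := by exact_mod_cast (Finset.mem_range.1 hj).le
        have := hq k
        rw [smul_eq_mul]
        constructor <;> intro _ <;> nlinarith
      · rw [smul_zero, add_zero]
    rw [mulSeries_qGeomSum]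
    by_cases hyC : (1 : ℝ) ⊗ₜ[ℚ] (y : V) ∈ openCone v S
    · have e : ∀ j ∈ Finset.range m, genCoeff f' (openCone v S) (y - j • u i) =
          (f'.tensorLp ((y - j • u i : L) : V) : ℚ) := fun j hj =>
        genCoeff_of_mem ((hmem j hj).2 hyC)
      -- Reversing the order turns the sum over `y - j • u i` into a sum over `x + j • u i` with `x
      -- = y - (m - 1) • u i`, where the cancellation hypothesis applies.
      rw [Finset.sum_congr rfl e, ← Finset.sum_range_reflect, ← Int.cast_sum]
      rw [← Int.cast_zero, ← hsum i (y - (m - 1) • u i)]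
      congr 1
      refine Finset.sum_congr rfl fun j hj => ?_
      congr 1
      have hj' := Finset.mem_range.1 hj
      have : (m - 1) • u i = (m - 1 - j) • u i + j • u i := by
        rw [← add_smul]
        congr 1
        omega
      rw [this]
      push_cast
      abel
    · exact Finset.sum_eq_zero fun j hj => genCoeff_of_notMem fun h => hyC ((hmem j hj).1 h)

theorem genCoeff_biUnion (f' : TestFunction p L) {ι : Type*} (𝓢 : Finset ι)
    (C : ι → Set (ℝ ⊗[ℚ] V)) (hdisj : ∀ S ∈ 𝓢, ∀ T ∈ 𝓢, S ≠ T → Disjoint (C S) (C T)) :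
    genCoeff f' (⋃ S ∈ 𝓢, C S) = ∑ S ∈ 𝓢, genCoeff f' (C S) := by
  funext x
  rw [Finset.sum_apply]
  by_cases hx : (1 : ℝ) ⊗ₜ[ℚ] (x : V) ∈ ⋃ S ∈ 𝓢, C S
  · obtain ⟨S, hS, hxS⟩ := Set.mem_iUnion₂.1 hx
    rw [Finset.sum_eq_single_of_mem S hS fun T hT hTS =>
      genCoeff_of_notMem (Set.disjoint_right.1 (hdisj T hT S hS hTS) hxS)]
    exact (genCoeff_of_mem hx).trans (genCoeff_of_mem hxS).symm
  · rw [Finset.sum_eq_zero fun S hS =>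
      genCoeff_of_notMem fun h => hx (Set.mem_iUnion₂.2 ⟨S, hS, h⟩)]
    exact genCoeff_of_notMem hx

end

end ShintaniMeasure

end

/-! ### The theorem for a general simplicial cone -/

open ShintaniMeasure
theorem theorem2p7 (p : ℕ) [Fact p.Prime] {V : Type*} [AddCommGroup V] [Module ℚ V]
    [FiniteDimensional ℚ V] (L : Submodule ℤ V) [L.IsLattice ℚ]
    (f' : TestFunction p L) (hf' : f'.SupportedOn)
    {r : ℕ} (v : Fin r → V) (C : Set (TensorProduct ℚ ℝ V)) (hC : IsSimplicialCone v C)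
    (hvan : ∀ i, f'.VanishingHypothesis (v i)) :
    ∃ μ : PseudoMeasure p L, IsPseudoMeasureOf f' C μ ∧ μ.IsMeasure := by
  obtain ⟨𝓢, hli, hdisj, hall, rfl⟩ := hC
  have hv : ∀ i, v i ≠ 0 := fun i => by
    obtain ⟨S, hS, hi⟩ := hall i
    exact (hli S hS).ne_zero ⟨i, hi⟩
  choose u q hq hu hprim using fun i => exists_primitive L (hv i)
  -- The period is taken on `∏ L_ℓ` itself, so a single `m` serves every ray and every open cone.
  obtain ⟨m, hm0, hm, hper⟩ := f'.exists_period (diag p L 0)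
  refine IsMeasureSeries.exists_isPseudoMeasureOf ?_
  rw [genCoeff_biUnion f' 𝓢 _ hdisj]
  exact isMeasureSeries_sum _ _ fun S hS =>
    isMeasureSeries_openCone f' (hli S hS) hq hu hm0 hm fun i x =>
      f'.sum_tensorLp_eq_zero hf' (hvan i) (hq i).ne' (hu i) (hprim i) hm0 hm hper x
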